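/- **Theorem.** The model of computation is a word RAM with words of $w=\Theta(\log N)$ bits, in which each of the following takes one step: loading a constant, the usual arithmetic ($+,-,\times$, integer division and remainder), bitwise and shift operations on words, comparison of two registers, reading a word of the (read-only) memory that holds the data structure, and each operation ($\oplus$, inverse, neutral element) of a given finite abelian group $(G,\oplus,{}^{-1},0)$ with $N=|G|$ elements, where group elements are represented by the numbers $0,\dots,N-1$ under an arbitrary fixed bijection. A program uses a constant number of working registers. Let $\kappa\ge 0$ be a fixed integer. Let $r\ge 2$ and $N$ satisfy $r\le N^{\kappa}$ (that is, $\log r=O(\log N)$), and let an $r\times r$ grid store $r$ points (several points may share a row, a column or a cell) with associated values in an abelian group $G$ of $N$ elements. Then for every $\varepsilon>0$ there is a data structure of $$O\bigl(\max(1,1/\varepsilon)\; r\log_2 N\bigr)$$ bits from which, for every rectangle $[x_1,x_2]\times[y_1,y_2]$ of the grid, the $\oplus$-sum of the values of the points in the rectangle is computed in time $$O\bigl(\max(1,1/\varepsilon)\,(\log_2 r)^{2+\varepsilon}\bigr).$$ The query program, the constant relating $w$ to $\log N$, and the constants hidden in the $O(\cdot)$ depend only on $\kappa$; in particular they do not depend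 on $\varepsilon$, $r$, $N$, $G$, the points or their values. (For $\varepsilon\le 1$ the factor $\max(1,1/\varepsilon)$ is $1/\varepsilon$.) -/

import Mathlib

/-! A word RAM with `w`-bit words, unit-cost steps, a read-only memory that holds the data
structure, finitely many working registers per program, and the operations of a finite group `G`
available as unit-cost instructions. An element of `G` is handled through its code, a number
below `N = |G|`. -/
namespace WordRAM

/-- Binary operations on words (arithmetic is modulo `2 ^ w`; division by zero gives zero). -/
inductive BinOp
  | add | sub | mul | div | mod | and | or | xor | shl | shr

def BinOp.eval {w : ℕ} : BinOp → BitVec w → BitVec w → BitVec w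
  | .add, a, b => a + b
  | .sub, a, b => a - b
  | .mul, a, b => a * b
  | .div, a, b => BitVec.ofNat w (a.toNat / b.toNat)
  | .mod, a, b => BitVec.ofNat w (a.toNat % b.toNat)
  | .and, a, b => a &&& b
  | .or, a, b => a ||| b
  | .xor, a, b => a ^^^ b
  | .shl, a, b => a <<< b.toNat
  | .shr, a, b => a >>> b.toNat

/-- Instructions; `d`, `a`, `b` are register names and `d` is the destination. -/
inductive Instr
  /-- load the constant `k` -/
  | const (d k : ℕ)
  /-- word operation -/
  | bin (o : BinOp) (d a b : ℕ)
  /-- read the memory word whose address is in register `a` -/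
  | load (d a : ℕ)
  /-- neutral element of the group -/
  | gzero (d : ℕ)
  /-- group operation -/
  | gadd (d a b : ℕ)
  /-- group inverse -/
  | gneg (d a : ℕ)

/-- Tests that compare two registers. -/
inductive Test
  | lt (a b : ℕ)
  | eq (a b : ℕ)

/-- Programs. They mention neither the word length nor the group nor the data. -/
inductive Prog
  | skip
  | instr (i : Instr)
  | seq (p q : Prog)
  | ite (b : Test) (p q : Prog)
  | loop (b : Test) (p : Prog)

/-- Contents of the registers. -/
abbrev Regs (w : ℕ) := ℕ → BitVec w

def Test.eval {w : ℕ} (s : Regs w) : Test → Bool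
  | .lt a b => decide ((s a).toNat < (s b).toNat)
  | .eq a b => decide (s a = s b)

section Semantics

variable {w N : ℕ} {G : Type*} [AddCommGroup G]

/-- The word that holds the code of a group element. -/
def encode (w : ℕ) (code : G ≃ Fin N) (g : G) : BitVec w :=
  BitVec.ofNat w (code g : ℕ)

/-- The group element whose code a word holds (`0` if the word is not a code). -/
def decode (code : G ≃ Fin N) (a : BitVec w) : G :=
  if h : a.toNat < N then code.symm ⟨a.toNat, h⟩ else 0

/-- The word that an instruction writes. Reading past the end of the memory gives `0`. -/
def Instr.value (mem : List (BitVec w)) (code : G ≃ Fin N) (s : Regs w) : Instr → BitVec w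
  | .const _ k => BitVec.ofNat w k
  | .bin o _ a b => o.eval (s a) (s b)
  | .load _ a => mem.getD (s a).toNat 0
  | .gzero _ => encode w code 0
  | .gadd _ a b => encode w code (decode code (s a) + decode code (s b))
  | .gneg _ a => encode w code (-decode code (s a))

/-- The register that an instruction writes. -/
def Instr.dest : Instr → ℕ
  | .const d _ => d
  | .bin _ d _ _ => d
  | .load d _ => d
  | .gzero d => d
  | .gadd d _ _ => d
  | .gneg d _ => d

/-- `Exec mem code p s s' t`: with memory `mem`, the program `p`, started with register contents
`s`, halts with register contents `s'` after exactly `t` steps. Each instruction and each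
evaluation of a test is one step. -/
inductive Exec (mem : List (BitVec w)) (code : G ≃ Fin N) :
    Prog → Regs w → Regs w → ℕ → Prop
  | skip (s : Regs w) : Exec mem code .skip s s 1
  | instr (i : Instr) (s : Regs w) :
      Exec mem code (.instr i) s (Function.update s i.dest (i.value mem code s)) 1
  | seq {p q : Prog} {s s' s'' : Regs w} {t t' : ℕ} :
      Exec mem code p s s' t → Exec mem code q s' s'' t' →
      Exec mem code (.seq p q) s s'' (t + t')
  | ite_true {b : Test} {p q : Prog} {s s' : Regs w} {t : ℕ} :
      b.eval s = true → Exec mem code p s s' t → Exec mem code (.ite b p q) s s' (t + 1)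
  | ite_false {b : Test} {p q : Prog} {s s' : Regs w} {t : ℕ} :
      b.eval s = false → Exec mem code q s s' t → Exec mem code (.ite b p q) s s' (t + 1)
  | loop_true {b : Test} {p : Prog} {s s' s'' : Regs w} {t t' : ℕ} :
      b.eval s = true → Exec mem code p s s' t → Exec mem code (.loop b p) s' s'' t' →
      Exec mem code (.loop b p) s s'' (t + t' + 1)
  | loop_false {b : Test} {p : Prog} {s : Regs w} :
      b.eval s = false → Exec mem code (.loop b p) s s 1

/-- The machine is deterministic: result and number of steps are determined by the start. -/
theorem Exec.deterministic {mem : List (BitVec w)} {code : G ≃ Fin N} {p : Prog}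
    {s s₁ s₂ : Regs w} {t₁ t₂ : ℕ} (h₁ : Exec mem code p s s₁ t₁)
    (h₂ : Exec mem code p s s₂ t₂) : s₁ = s₂ ∧ t₁ = t₂ := by
  induction h₁ generalizing s₂ t₂ with
  | skip => cases h₂; exact ⟨rfl, rfl⟩
  | instr => cases h₂; exact ⟨rfl, rfl⟩
  | seq _ _ ih ih' =>
    cases h₂ with
    | seq k k' =>
      obtain ⟨rfl, rfl⟩ := ih k
      obtain ⟨rfl, rfl⟩ := ih' k'
      exact ⟨rfl, rfl⟩
  | ite_true hb _ ih =>
    cases h₂ with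
    | ite_true _ k => obtain ⟨rfl, rfl⟩ := ih k; exact ⟨rfl, rfl⟩
    | ite_false hb' _ => simp [hb] at hb'
  | ite_false hb _ ih =>
    cases h₂ with
    | ite_true hb' _ => simp [hb] at hb'
    | ite_false _ k => obtain ⟨rfl, rfl⟩ := ih k; exact ⟨rfl, rfl⟩
  | loop_true hb _ _ ih ih' =>
    cases h₂ with
    | loop_true _ k k' =>
      obtain ⟨rfl, rfl⟩ := ih k
      obtain ⟨rfl, rfl⟩ := ih' k'
      exact ⟨rfl, rfl⟩
    | loop_false hb' => simp [hb] at hb'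
  | loop_false hb =>
    cases h₂ with
    | loop_true hb' _ _ => simp [hb] at hb'
    | loop_false _ => exact ⟨rfl, rfl⟩

end Semantics

/-- Initial register contents: the four inputs in registers `0` to `3`, and `0` elsewhere. -/
def initRegs (w a b c d : ℕ) : Regs w
  | 0 => BitVec.ofNat w a
  | 1 => BitVec.ofNat w b
  | 2 => BitVec.ofNat w c
  | 3 => BitVec.ofNat w d
  | _ => 0

end WordRAM

/-- The sum of the values `v i` of those points `p i` that lie in `[x₁, x₂] × [y₁, y₂]`. -/
def rectSum {r : ℕ} {G : Type*} [AddCommGroup G] (p : Fin r → Fin r × Fin r) (v : Fin r → G)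
    (x₁ x₂ y₁ y₂ : Fin r) : G :=
  ∑ i with x₁ ≤ (p i).1 ∧ (p i).1 ≤ x₂ ∧ y₁ ≤ (p i).2 ∧ (p i).2 ≤ y₂, v i

/-! The points are kept in a wavelet matrix: written in base `2 ^ a`, where `2 ^ a` is about
`(log r) ^ (ε / 2)`, and with the digits reversed, the columns are radix sorted stably, one digit
per level, starting from the order by rows. A rectangle sum is an alternating sum of four corner
sums. The points of a corner are classified by the most significant digit in which their column
falls below the bound. Those that belong to one level are the points with smaller digits in an
interval of that level, so each level contributes a difference of two prefix sums.

Prefix sums are stored for every `block`-th position only, so that they take `O(r)` words in all,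
and the fewer than `block` remaining points are scanned. Rows, columns and values are stored for the
last level only; a scanned point, and likewise a point probed by the binary search for the ends of
an interval, is followed to the last level. With `Q = 2 ^ a`, a level whose distance to the last one
is a multiple of `Q ^ j` has jumps over `Q ^ j` levels. Hence `O(Q K)` jumps suffice as soon as
`Q ^ K` exceeds the number of levels, which holds for some `K = O(max 1 (1 / ε))`, while the digits
skipped by all jumps of a point have only `O(K log r)` bits. A jump sorts the points stably by the
skipped digits, so it is determined by these digits and the number of points with the same digits
that come before: the part of this number inside a block is stored with the digits, the rest in a
table of block offsets. -/

/-! ### Compiling expressions -/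

namespace WordRAM

/-- An expression in compiled form: `c n` is the program that evaluates the expression when the
registers below `n` are in use. It leaves the value in register `n` and does not change the
registers below `n`. -/
def Code := ℕ → Prog

namespace Code

/-- The program that copies register `a` to register `d`. -/
def move (d a : ℕ) : Prog :=
  .seq (.instr (.const d 0)) (.instr (.bin .add d d a))

/-- The contents of register `k`. -/
def reg (k : ℕ) : Code := fun n => move n k

/-- A constant. -/
def lit (k : ℕ) : Code := fun n => .instr (.const n k)

/-- A word operation. -/
def bin (o : BinOp) (a b : Code) : Code := fun n =>
  .seq (a n) (.seq (b (n + 1)) (.instr (.bin o n n (n + 1))))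

instance : Add Code := ⟨bin .add⟩
instance : Sub Code := ⟨bin .sub⟩
instance : Mul Code := ⟨bin .mul⟩
instance : Div Code := ⟨bin .div⟩
instance : Mod Code := ⟨bin .mod⟩
instance : HShiftRight Code Code Code := ⟨bin .shr⟩
instance (k : ℕ) : OfNat Code k := ⟨lit k⟩

/-- The memory word at a computed address. -/
def load (a : Code) : Code := fun n => .seq (a n) (.instr (.load n n))

/-- The neutral element of the group. -/
def gzero : Code := fun n => .instr (.gzero n)

/-- The sum of two group elements. -/
def gadd (a b : Code) : Code := fun n =>
  .seq (a n) (.seq (b (n + 1)) (.instr (.gadd n n (n + 1))))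

/-- The inverse of a group element. -/
def gneg (a : Code) : Code := fun n => .seq (a n) (.instr (.gneg n n))

/-- `let z := a; f z`. -/
def letE (a : Code) (f : Code → Code) : Code := fun n =>
  .seq (a n) (.seq (f (reg n) (n + 1)) (move n (n + 1)))

/-- `if a < b then c else d`. -/
def iteLt (a b c d : Code) : Code := fun n =>
  .seq (a n) (.seq (b (n + 1)) (.ite (.lt n (n + 1)) (c n) (d n)))

/-- One round of `forLoop`: the accumulator is in register `n`, the round number in register
`n + 2`. -/
def round (body : Code → Code → Code) (n : ℕ) : Prog :=
  .seq (body (reg n) (reg (n + 2)) (n + 3)) <| .seq (move n (n + 3)) <|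
    .seq (.instr (.const (n + 3) 1)) <| .instr (.bin .add (n + 2) (n + 2) (n + 3))

/-- `acc := init; for i in 0, …, count - 1 do acc := body acc i`. -/
def forLoop (count init : Code) (body : Code → Code → Code) : Code := fun n =>
  .seq (init n) <| .seq (count (n + 1)) <| .seq (.instr (.const (n + 2) 0)) <|
    .loop (.lt (n + 2) (n + 1)) (round body n)

end Code

/-- The registers in use: those with a number below `depth`. -/
structure Frame (w : ℕ) where
  depth : ℕ
  regs : Regs w

/-- `F ≤ F'` if the registers in use in `F` are in use in `F'` with the same contents. -/
instance (w : ℕ) : Preorder (Frame w) where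
  le F F' := F.depth ≤ F'.depth ∧ ∀ k < F.depth, F'.regs k = F.regs k
  le_refl _ := ⟨le_rfl, fun _ _ => rfl⟩
  le_trans _ _ _ h h' :=
    ⟨h.1.trans h'.1, fun k hk => (h'.2 k (hk.trans_le h.1)).trans (h.2 k hk)⟩

variable {w N : ℕ} {G : Type*} [AddCommGroup G] {mem : List (BitVec w)} {code : G ≃ Fin N}

theorem Frame.le_update (F : Frame w) {k : ℕ} (hk : F.depth ≤ k) {n : ℕ} (hn : F.depth ≤ n)
    (a : BitVec w) : F ≤ ⟨n, Function.update F.regs k a⟩ :=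
  ⟨hn, fun _ hj => Function.update_of_ne (hj.trans_le hk).ne _ _⟩

/-- In every frame that extends `F`, the expression `c` has the value `x` and is evaluated in at
most `T` steps. -/
def Computes (mem : List (BitVec w)) (code : G ≃ Fin N) (F : Frame w) (c : Code) (x T : ℕ) : Prop :=
  ∀ F' ≥ F, ∃ s t, Exec mem code (c F'.depth) F'.regs s t ∧ F' ≤ ⟨F'.depth + 1, s⟩ ∧
    (s F'.depth).toNat = x ∧ t ≤ T

namespace Computes

open Code

variable {F F' : Frame w} {a b c d : Code} {x y z T₁ T₂ T₃ : ℕ}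

theorem mono (h : Computes mem code F c x T₁) (hF : F ≤ F') : Computes mem code F' c x T₁ :=
  fun F'' hF'' => h F'' (hF.trans hF'')

theorem of_eq_of_le (h : Computes mem code F c x T₁) (hx : x = y) (hT : T₁ ≤ T₂) :
    Computes mem code F c y T₂ := fun F' hF' =>
  let ⟨s, t, hs, hle, hv, ht⟩ := h F' hF'
  ⟨s, t, hs, hle, hv.trans hx, ht.trans hT⟩

theorem lt_two_pow (h : Computes mem code F c x T₁) : x < 2 ^ w :=
  let ⟨s, _, _, _, hv, _⟩ := h F le_rfl
  hv ▸ (s F.depth).isLt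

theorem exec_move (s : Regs w) {i j : ℕ} (h : i ≠ j) :
    Exec mem code (move i j) s (Function.update s i (s j)) 2 := by
  have := Exec.seq (.instr (mem := mem) (code := code) (.const i 0) s)
    (.instr (.bin .add i i j) _)
  simpa [move, Instr.value, Instr.dest, BinOp.eval, h.symm] using this

theorem reg {k : ℕ} (hk : k < F.depth) : Computes mem code F (reg k) (F.regs k).toNat 2 := by
  intro F' hF
  have hk' : k < F'.depth := hk.trans_le hF.1
  refine ⟨_, _, exec_move _ hk'.ne', F'.le_update le_rfl (Nat.le_succ _) _, ?_, le_rfl⟩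
  rw [Function.update_self, hF.2 k hk]

theorem nullary {I : ℕ → Instr} (hI : ∀ n, (I n).dest = n)
    (hz : ∀ (s : Regs w) (n : ℕ), ((I n).value mem code s).toNat = z) :
    Computes mem code F (fun n => .instr (I n)) z 1 := fun F' _ =>
  ⟨_, _, .instr _ _, F'.le_update (hI _).ge (Nat.le_succ _) _, by
    rw [hI, Function.update_self, hz], le_rfl⟩

theorem unary {I : ℕ → Instr} (hI : ∀ n, (I n).dest = n) (ha : Computes mem code F a x T₁)
    (hz : ∀ (s : Regs w) (n : ℕ), (s n).toNat = x → ((I n).value mem code s).toNat = z) :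
    Computes mem code F (fun n => .seq (a n) (.instr (I n))) z (T₁ + 1) := by
  intro F' hF
  obtain ⟨s, t, h, hF₁, hx, ht⟩ := ha F' hF
  have hle : F' ≤ ⟨F'.depth, s⟩ := ⟨le_rfl, hF₁.2⟩
  refine ⟨_, _, .seq h (.instr _ _), hle.trans ?_, ?_, Nat.add_le_add_right ht 1⟩
  · exact Frame.le_update _ (hI _).ge (Nat.le_succ _) _
  · rw [hI, Function.update_self]
    exact hz _ _ hx

theorem binary {I : ℕ → Instr} (hI : ∀ n, (I n).dest = n)
    (ha : Computes mem code F a x T₁) (hb : Computes mem code F b y T₂)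
    (hz : ∀ (s : Regs w) (n : ℕ), (s n).toNat = x → (s (n + 1)).toNat = y →
      ((I n).value mem code s).toNat = z) :
    Computes mem code F (fun n => .seq (a n) (.seq (b (n + 1)) (.instr (I n)))) z
      (T₁ + T₂ + 1) := by
  intro F' hF
  obtain ⟨s₁, t₁, h₁, hF₁, hx, ht₁⟩ := ha F' hF
  obtain ⟨s₂, t₂, h₂, hF₂, hy, ht₂⟩ := hb ⟨F'.depth + 1, s₁⟩ (hF.trans hF₁)
  have hx₂ : s₂ F'.depth = s₁ F'.depth := hF₂.2 _ (Nat.lt_succ_self _)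
  have hle : F' ≤ ⟨F'.depth, s₂⟩ := ⟨le_rfl, (hF₁.trans hF₂).2⟩
  refine ⟨_, _, .seq h₁ (.seq h₂ (.instr _ _)), hle.trans ?_, ?_, by omega⟩
  · exact Frame.le_update _ (hI _).ge (Nat.le_succ _) _
  · rw [hI, Function.update_self]
    exact hz _ _ (by rw [hx₂, hx]) hy

theorem lit {k : ℕ} (hk : k < 2 ^ w) : Computes mem code F (lit k) k 1 :=
  nullary (fun _ => rfl) fun _ _ => by simp [Instr.value, Nat.mod_eq_of_lt hk]

theorem add (ha : Computes mem code F a x T₁) (hb : Computes mem code F b y T₂)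
    (hxy : x + y < 2 ^ w) : Computes mem code F (a + b) (x + y) (T₁ + T₂ + 1) :=
  binary (fun _ => rfl) ha hb fun _ _ hx hy => by
    simp [Instr.value, BinOp.eval, hx, hy, Nat.mod_eq_of_lt hxy]

theorem sub (ha : Computes mem code F a x T₁) (hb : Computes mem code F b y T₂)
    (hxy : y ≤ x) : Computes mem code F (a - b) (x - y) (T₁ + T₂ + 1) :=
  binary (fun _ => rfl) ha hb fun _ _ hx hy => by
    rw [Instr.value, BinOp.eval, BitVec.toNat_sub_of_le (by rw [BitVec.le_def, hx, hy]; exact hxy),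
      hx, hy]

theorem mul (ha : Computes mem code F a x T₁) (hb : Computes mem code F b y T₂)
    (hxy : x * y < 2 ^ w) : Computes mem code F (a * b) (x * y) (T₁ + T₂ + 1) :=
  binary (fun _ => rfl) ha hb fun _ _ hx hy => by
    simp [Instr.value, BinOp.eval, hx, hy, Nat.mod_eq_of_lt hxy]

theorem div (ha : Computes mem code F a x T₁) (hb : Computes mem code F b y T₂) :
    Computes mem code F (a / b) (x / y) (T₁ + T₂ + 1) :=
  binary (fun _ => rfl) ha hb fun _ _ hx hy => by
    simp [Instr.value, BinOp.eval, hx, hy,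
      Nat.mod_eq_of_lt ((Nat.div_le_self x y).trans_lt ha.lt_two_pow)]

theorem mod (ha : Computes mem code F a x T₁) (hb : Computes mem code F b y T₂) :
    Computes mem code F (a % b) (x % y) (T₁ + T₂ + 1) :=
  binary (fun _ => rfl) ha hb fun _ _ hx hy => by
    simp [Instr.value, BinOp.eval, hx, hy,
      Nat.mod_eq_of_lt ((Nat.mod_le x y).trans_lt ha.lt_two_pow)]

theorem shiftRight (ha : Computes mem code F a x T₁) (hb : Computes mem code F b y T₂) :
    Computes mem code F (a >>> b) (x / 2 ^ y) (T₁ + T₂ + 1) :=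
  binary (fun _ => rfl) ha hb fun _ _ hx hy => by
    simp [Instr.value, BinOp.eval, hx, hy, Nat.shiftRight_eq_div_pow]

theorem load (ha : Computes mem code F a x T₁) {z : BitVec w} (hz : mem[x]? = some z) :
    Computes mem code F (load a) z.toNat (T₁ + 1) :=
  unary (fun _ => rfl) ha fun _ _ hx => by simp [Instr.value, hx, List.getD, hz]

omit [AddCommGroup G] in
theorem toNat_encode (hN : N ≤ 2 ^ w) (g : G) : (encode w code g).toNat = code g := by
  simp [encode, Nat.mod_eq_of_lt ((code g).2.trans_le hN)]

theorem decode_eq {k : BitVec w} {g : G} (h : k.toNat = code g) : decode code k = g := by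
  simp [decode, h]

theorem gzero (hN : N ≤ 2 ^ w) : Computes mem code F gzero (code 0) 1 :=
  nullary (fun _ => rfl) fun _ _ => toNat_encode hN 0

theorem gadd (hN : N ≤ 2 ^ w) {g g' : G} (ha : Computes mem code F a (code g) T₁)
    (hb : Computes mem code F b (code g') T₂) :
    Computes mem code F (gadd a b) (code (g + g')) (T₁ + T₂ + 1) :=
  binary (fun _ => rfl) ha hb fun _ _ hx hy => by
    rw [Instr.value, decode_eq hx, decode_eq hy, toNat_encode hN]

theorem gneg (hN : N ≤ 2 ^ w) {g : G} (ha : Computes mem code F a (code g) T₁) :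
    Computes mem code F (gneg a) (code (-g)) (T₁ + 1) :=
  unary (fun _ => rfl) ha fun _ _ hx => by rw [Instr.value, decode_eq hx, toNat_encode hN]

theorem letE {f : Code → Code} (ha : Computes mem code F a x T₁)
    (hf : ∀ F' ≥ F, ∀ z, Computes mem code F' z x 2 → Computes mem code F' (f z) y T₂) :
    Computes mem code F (letE a f) y (T₁ + T₂ + 2) := by
  intro F' hF
  obtain ⟨s₁, t₁, h₁, hF₁, hx, ht₁⟩ := ha F' hF
  have hz : Computes mem code ⟨F'.depth + 1, s₁⟩ (Code.reg F'.depth) x 2 :=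
    (Computes.reg (Nat.lt_succ_self _)).of_eq_of_le hx le_rfl
  obtain ⟨s₂, t₂, h₂, hF₂, hy, ht₂⟩ := hf _ (hF.trans hF₁) _ hz _ le_rfl
  have hle : F' ≤ ⟨F'.depth, s₂⟩ := ⟨le_rfl, (hF₁.trans hF₂).2⟩
  refine ⟨_, _, .seq h₁ (.seq h₂ (exec_move _ (Nat.lt_succ_self _).ne)), ?_, ?_, by omega⟩
  · exact hle.trans (Frame.le_update _ le_rfl (Nat.le_succ _) _)
  · rw [Function.update_self, hy]

theorem iteLt (ha : Computes mem code F a x T₁) (hb : Computes mem code F b y T₂)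
    (hc : x < y → Computes mem code F c z T₃) (hd : y ≤ x → Computes mem code F d z T₃) :
    Computes mem code F (iteLt a b c d) z (T₁ + T₂ + T₃ + 1) := by
  intro F' hF
  obtain ⟨s₁, t₁, h₁, hF₁, hx, ht₁⟩ := ha F' hF
  obtain ⟨s₂, t₂, h₂, hF₂, hy, ht₂⟩ := hb ⟨F'.depth + 1, s₁⟩ (hF.trans hF₁)
  have hx₂ : (s₂ F'.depth).toNat = x := by rw [← hx]; exact congrArg _ (hF₂.2 _ (by simp))
  have hle : F' ≤ ⟨F'.depth, s₂⟩ := ⟨le_rfl, (hF₁.trans hF₂).2⟩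
  rcases lt_or_ge x y with hxy | hxy
  · obtain ⟨s₃, t₃, h₃, hF₃, hz, ht₃⟩ := hc hxy _ (hF.trans hle)
    exact ⟨s₃, _, .seq h₁ (.seq h₂ (.ite_true (by simpa [Test.eval, hx₂, hy]) h₃)),
      hle.trans hF₃, hz, by omega⟩
  · obtain ⟨s₃, t₃, h₃, hF₃, hz, ht₃⟩ := hd hxy _ (hF.trans hle)
    exact ⟨s₃, _, .seq h₁ (.seq h₂ (.ite_false (by simpa [Test.eval, hx₂, hy]) h₃)),
      hle.trans hF₃, hz, by omega⟩

/-- The registers of a `forLoop` in frame `F` before round `i`. -/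
structure LoopState (F : Frame w) (s : Regs w) (x i m : ℕ) : Prop where
  frame : F ≤ ⟨F.depth + 3, s⟩
  acc : (s F.depth).toNat = x
  count : (s (F.depth + 1)).toNat = m
  index : (s (F.depth + 2)).toNat = i

theorem exec_round {body : Code → Code → Code} {x' i m : ℕ} {s : Regs w}
    (hs : LoopState F s x i m) (him : i < m)
    (hbody : ∀ F' ≥ F, ∀ u v, Computes mem code F' u x 2 → Computes mem code F' v i 2 →
      Computes mem code F' (body u v) x' T₁) :
    ∃ s' t, Exec mem code (round body F.depth) s s' t ∧
      LoopState F s' x' (i + 1) m ∧ t ≤ T₁ + 4 := by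
  have hm : i + 1 < 2 ^ w := (Nat.succ_le_of_lt him).trans_lt (hs.count ▸ BitVec.isLt _)
  obtain ⟨s₁, t₁, h₁, hF₁, hx, ht₁⟩ := hbody _ hs.frame _ _
    ((Computes.reg (F := ⟨F.depth + 3, s⟩) (by simp)).of_eq_of_le hs.acc le_rfl)
    ((Computes.reg (F := ⟨F.depth + 3, s⟩) (by simp)).of_eq_of_le hs.index le_rfl) _ le_rfl
  refine ⟨_, _, .seq h₁ (.seq (exec_move _ (by omega)) (.seq (.instr _ _) (.instr _ _))), ?_,
    by omega⟩
  have hcount : s₁ (F.depth + 1) = s (F.depth + 1) := hF₁.2 _ (by simp)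
  have hindex : s₁ (F.depth + 2) = s (F.depth + 2) := hF₁.2 _ (by simp)
  have h1 : 1 < 2 ^ w := by omega
  constructor
  · refine ⟨Nat.le_add_right _ 3, fun k hk => ?_⟩
    have hk' : s₁ k = F.regs k := (hs.frame.trans hF₁).2 k hk
    simp (disch := omega) [Instr.dest, hk']
  · simp [Instr.dest, hx]
  · simp [Instr.dest, hcount, hs.count]
  · simp [Instr.dest, Instr.value, BinOp.eval, hindex, hs.index, Nat.mod_eq_of_lt h1,
      Nat.mod_eq_of_lt hm]

theorem exec_loop {body : Code → Code → Code} {x : ℕ → ℕ} {m : ℕ}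
    (hbody : ∀ i < m, ∀ F' ≥ F, ∀ u v, Computes mem code F' u (x i) 2 →
      Computes mem code F' v i 2 → Computes mem code F' (body u v) (x (i + 1)) T₁)
    (j : ℕ) {i : ℕ} (hij : i + j = m) {s : Regs w} (hs : LoopState F s (x i) i m) :
    ∃ s' t, Exec mem code (.loop (.lt (F.depth + 2) (F.depth + 1)) (round body F.depth)) s s' t ∧
      LoopState F s' (x m) m m ∧ t ≤ j * (T₁ + 5) + 1 := by
  induction j generalizing i s with
  | zero =>
    obtain rfl : i = m := hij
    exact ⟨s, 1, .loop_false (by simp [Test.eval, hs.count, hs.index]), hs, by omega⟩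
  | succ j ih =>
    obtain ⟨s', t', h', hs', ht'⟩ := exec_round hs (by omega) (hbody i (by omega))
    obtain ⟨s'', t'', h'', hs'', ht''⟩ := ih (by omega) hs'
    exact ⟨s'', _, .loop_true (by simp [Test.eval, hs.count, hs.index]; omega) h' h'', hs'',
      by rw [Nat.succ_mul]; omega⟩

theorem forLoop {count init : Code} {body : Code → Code → Code} {x : ℕ → ℕ} {m : ℕ}
    (hinit : Computes mem code F init (x 0) T₁) (hcount : Computes mem code F count m T₂)
    (hbody : ∀ i < m, ∀ F' ≥ F, ∀ u v, Computes mem code F' u (x i) 2 →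
      Computes mem code F' v i 2 → Computes mem code F' (body u v) (x (i + 1)) T₃) :
    Computes mem code F (forLoop count init body) (x m) (T₁ + T₂ + m * (T₃ + 5) + 2) := by
  intro F' hF
  obtain ⟨s₁, t₁, h₁, hF₁, hx, ht₁⟩ := hinit F' hF
  obtain ⟨s₂, t₂, h₂, hF₂, hm, ht₂⟩ := hcount ⟨F'.depth + 1, s₁⟩ (hF.trans hF₁)
  have hstart : LoopState F' (Function.update s₂ (F'.depth + 2) 0) (x 0) 0 m := by
    refine ⟨⟨Nat.le_add_right _ 3, fun k hk => ?_⟩, ?_, ?_, by simp⟩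
    · have hk' : s₂ k = F'.regs k := (hF₁.trans hF₂).2 k hk
      simp (disch := omega) [hk']
    · have hx₂ : s₂ F'.depth = s₁ F'.depth := hF₂.2 _ (Nat.lt_succ_self _)
      simp [hx₂, hx]
    · simpa using hm
  obtain ⟨s₃, t₃, h₃, hs₃, ht₃⟩ :=
    exec_loop (fun i hi F'' hF'' => hbody i hi F'' (hF.trans hF'')) m (Nat.zero_add m) hstart
  exact ⟨s₃, _, .seq h₁ (.seq h₂ (.seq (.instr _ _) h₃)), ⟨Nat.le_succ _, hs₃.frame.2⟩, hs₃.acc,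
    by omega⟩

end Computes

section Segments

variable (S : ℕ → List ℕ) (m : ℕ)

/-- The address at which `pack S m` stores `S j`. -/
def segmentAddress (j : ℕ) : ℕ := m + ((List.range j).flatMap S).length

/-- The lists `S 0`, …, `S (m - 1)` one after the other, preceded by their `m` addresses. -/
def pack : List ℕ := (List.range m).map (segmentAddress S m) ++ (List.range m).flatMap S

theorem length_pack : (pack S m).length = m + ∑ j ∈ Finset.range m, (S j).length := by
  rw [pack, List.length_append, List.length_map, List.length_range, List.length_flatMap]
  rfl

variable {S m} {i j x : ℕ}

theorem getElem?_pack_of_lt (hj : j < m) : (pack S m)[j]? = some (segmentAddress S m j) := by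
  rw [pack, List.getElem?_append_left (by simpa using hj)]
  simp [hj]

theorem getElem?_flatMap_range (hj : j < m) (hx : (S j)[i]? = some x) :
    ((List.range m).flatMap S)[((List.range j).flatMap S).length + i]? = some x := by
  induction m, hj using Nat.le_induction with
  | base =>
    rw [List.range_succ, List.flatMap_append, List.getElem?_append_right (Nat.le_add_right _ _)]
    simpa using hx
  | succ m _ ih =>
    rw [List.range_succ, List.flatMap_append,
      List.getElem?_append_left (List.getElem?_eq_some_iff.1 ih).1, ih]

theorem getElem?_pack (hj : j < m) (hx : (S j)[i]? = some x) :
    (pack S m)[segmentAddress S m j + i]? = some x := by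
  rw [pack, segmentAddress, List.getElem?_append_right (by simp; omega), List.length_map,
    List.length_range, add_assoc, Nat.add_sub_cancel_left, getElem?_flatMap_range hj hx]

variable {w N : ℕ} {G : Type*} [AddCommGroup G] {mem : List (BitVec w)} {code : G ≃ Fin N}

/-- The memory `mem` consists of the words of `pack S m`, and they fit into `w` bits. -/
structure StoresSegments (mem : List (BitVec w)) (S : ℕ → List ℕ) (m : ℕ) : Prop where
  eq_map : mem = (pack S m).map (BitVec.ofNat w)
  length_lt : (pack S m).length < 2 ^ w
  word_lt : ∀ j < m, ∀ x ∈ S j, x < 2 ^ w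

/-- The word `i` of the segment `j`. -/
def Code.segment (j i : Code) : Code := load (load j + i)

theorem Computes.load_pack {F : Frame w} {a : Code} {k T : ℕ} (hM : StoresSegments mem S m)
    (ha : Computes mem code F a k T) (hx : (pack S m)[k]? = some x) (hxw : x < 2 ^ w) :
    Computes mem code F (.load a) x (T + 1) :=
  (ha.load (z := BitVec.ofNat w x) (by rw [hM.eq_map, List.getElem?_map, hx]; rfl)).of_eq_of_le
    (by rw [BitVec.toNat_ofNat, Nat.mod_eq_of_lt hxw]) le_rfl

theorem Computes.segment {F : Frame w} {a b : Code} {T₁ T₂ : ℕ} (hM : StoresSegments mem S m)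
    (ha : Computes mem code F a j T₁) (hb : Computes mem code F b i T₂) (hj : j < m)
    (hx : (S j)[i]? = some x) : Computes mem code F (.segment a b) x (T₁ + T₂ + 3) := by
  have haddr : segmentAddress S m j + i < 2 ^ w :=
    (List.getElem?_eq_some_iff.1 (getElem?_pack hj hx)).1.trans hM.length_lt
  have hload := load_pack hM ha (getElem?_pack_of_lt hj) (by omega)
  exact (load_pack hM (hload.add hb haddr) (getElem?_pack hj hx)
    (hM.word_lt j hj x (List.mem_of_getElem? hx))).of_eq_of_le rfl (by omega)

end Segments

end WordRAM

/-! ### Ranks, digits and jumps -/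

open Finset

section Rank

variable {r : ℕ} {k k' : Fin r → ℕ}

/-- The position of each index when the indices are sorted by the key `k`. -/
def keyRank (k : Fin r → ℕ) : Equiv.Perm (Fin r) := (Tuple.sort k).symm

theorem keyRank_lt_keyRank (hk : k.Injective) {q q' : Fin r} :
    keyRank k q < keyRank k q' ↔ k q < k q' := by
  have hmono : StrictMono (k ∘ Tuple.sort k) :=
    (Tuple.monotone_sort k).strictMono_of_injective (hk.comp (Tuple.sort k).injective)
  simpa [keyRank] using (hmono.lt_iff_lt (a := keyRank k q) (b := keyRank k q')).symm

theorem keyRank_eq_card (hk : k.Injective) (q : Fin r) :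
    (keyRank k q : ℕ) = #{q' | k q' < k q} := by
  have hpre : ({q' | k q' < k q} : Finset (Fin r)) =
      (Iio (keyRank k q)).map (keyRank k).symm.toEmbedding := by
    ext q'
    simp [keyRank_lt_keyRank hk]
  rw [hpre, card_map, Fin.card_Iio]

theorem keyRank_lt_card_iff (hk : k.Injective) (q : Fin r) (t : ℕ) :
    (keyRank k q : ℕ) < #{q' | k q' < t} ↔ k q < t := by
  rw [keyRank_eq_card hk]
  refine ⟨fun h => ?_, fun h => card_lt_card (ssubset_iff.2 ⟨q, by simp, ?_⟩)⟩
  · by_contra! ht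
    exact h.not_ge (card_le_card (monotone_filter_right _ fun q' _ hq' => hq'.trans_le ht))
  · simpa [insert_subset_iff, h, subset_iff] using fun q' (hq' : k q' < k q) => hq'.trans h

theorem keyRank_eq_add_of_lex (hk : k.Injective) (hk' : k'.Injective) {c : Fin r → ℕ}
    (hlex : ∀ q q', k' q' < k' q ↔ c q' < c q ∨ c q' = c q ∧ k q' < k q) {q : Fin r} {m : ℕ}
    (hm : m ≤ keyRank k q) :
    (keyRank k' q : ℕ) = #{q' | c q' < c q ∨ c q' = c q ∧ keyRank k q' < m} +
      #{q' | c q' = c q ∧ m ≤ keyRank k q' ∧ keyRank k q' < keyRank k q} := by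
  rw [keyRank_eq_card hk', ← card_union_of_disjoint]
  · congr 1
    ext q'
    simp only [hlex, ← keyRank_lt_keyRank hk, mem_filter, mem_union, mem_univ, true_and,
      Fin.lt_def]
    omega
  · exact disjoint_filter.2 fun q' _ h => by omega

theorem card_keyRank_Ico_le (k : Fin r → ℕ) (P : Fin r → Prop) [DecidablePred P] (m n : ℕ) :
    #{q | P q ∧ m ≤ keyRank k q ∧ keyRank k q < n} ≤ n - m := by
  rw [← Nat.card_Ico]
  refine card_le_card_of_injOn (fun q => (keyRank k q : ℕ)) (fun q hq => ?_) ?_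
  · simpa using (by simpa using hq : _ ∧ _ ∧ _).2
  · exact fun _ _ _ _ h => (keyRank k).injective (Fin.ext h)

end Rank

section DigitReversal

theorem mul_add_lt_mul_add_iff {u v k y m : ℕ} (hk : k < m) (hy : y ≤ m) :
    u * m + k < v * m + y ↔ u < v ∨ u = v ∧ k < y := by
  rcases lt_trichotomy u v with h | rfl | h
  · have := Nat.mul_le_mul_right m (Nat.succ_le_of_lt h)
    rw [Nat.succ_mul] at this
    exact iff_of_true (by omega) (.inl h)
  · simp
  · have := Nat.mul_le_mul_right m (Nat.succ_le_of_lt h)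
    rw [Nat.succ_mul] at this
    exact iff_of_false (by omega) (by omega)

theorem lt_iff_div_lt_or_div_eq_and_mod_lt {Q : ℕ} (hQ : 0 < Q) (x y : ℕ) :
    x < y ↔ x / Q < y / Q ∨ x / Q = y / Q ∧ x % Q < y % Q := by
  conv_lhs => rw [← Nat.div_add_mod' x Q, ← Nat.div_add_mod' y Q]
  exact mul_add_lt_mul_add_iff (Nat.mod_lt x hQ) (Nat.mod_lt y hQ).le

/-- The number whose `h` lowest base-`Q` digits are those of `x` in reverse order. -/
def digitRev (Q : ℕ) : ℕ → ℕ → ℕ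
  | 0, _ => 0
  | h + 1, x => Q ^ h * (x % Q) + digitRev Q h (x / Q)

variable {Q : ℕ}

theorem digitRev_lt (hQ : 0 < Q) (h x : ℕ) : digitRev Q h x < Q ^ h := by
  induction h generalizing x with
  | zero => simp [digitRev]
  | succ h ih =>
    calc Q ^ h * (x % Q) + digitRev Q h (x / Q)
      _ < Q ^ h * (x % Q) + Q ^ h := Nat.add_lt_add_left (ih _) _
      _ = Q ^ h * (x % Q + 1) := (Nat.mul_succ _ _).symm
      _ ≤ Q ^ h * Q := Nat.mul_le_mul_left _ (Nat.mod_lt x hQ)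

theorem digitRev_mod_pow (hQ : 0 < Q) (l m x : ℕ) :
    digitRev Q (l + m) x % Q ^ l = digitRev Q l (x / Q ^ m) := by
  induction m generalizing x with
  | zero => simp [Nat.mod_eq_of_lt (digitRev_lt hQ l x)]
  | succ m ih =>
    rw [← add_assoc, digitRev, pow_add, mul_assoc, Nat.mul_add_mod, ih, Nat.div_div_eq_div_mul,
      pow_succ']

theorem digitRev_div_pow_mod (hQ : 0 < Q) (l m x : ℕ) :
    digitRev Q (l + m + 1) x / Q ^ l % Q = x / Q ^ m % Q := by
  rw [← Nat.mod_mul_right_div_self, ← pow_succ, add_right_comm, digitRev_mod_pow hQ, digitRev,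
    Nat.mul_add_div (Nat.pow_pos hQ), Nat.div_eq_of_lt (digitRev_lt hQ _ _), add_zero]

theorem digitRev_injOn (Q h : ℕ) : Set.InjOn (digitRev Q h) (Set.Iio (Q ^ h)) := by
  induction h with
  | zero => intro x hx y hy _; simp_all
  | succ h ih =>
    intro x hx y hy hxy
    rw [Set.mem_Iio, pow_succ] at hx hy
    have hQ : 0 < Q := Nat.pos_of_mul_pos_left (pos_of_gt hx)
    have hdigit : x % Q = y % Q := by
      simpa only [digitRev_div_pow_mod hQ h 0, pow_zero, Nat.div_one] using
        congrArg (· / Q ^ h % Q) hxy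
    have hrest : digitRev Q h (x / Q) = digitRev Q h (y / Q) := by
      simpa only [digitRev_mod_pow hQ h 1, pow_one] using congrArg (· % Q ^ h) hxy
    have hdiv := ih (Nat.div_lt_of_lt_mul (mul_comm (Q ^ h) Q ▸ hx))
      (Nat.div_lt_of_lt_mul (mul_comm (Q ^ h) Q ▸ hy)) hrest
    rw [← Nat.div_add_mod x Q, ← Nat.div_add_mod y Q, hdiv, hdigit]

variable {M : Type*} [AddCommMonoid M] (a : M)

theorem sum_ite_digit_lt_add (hQ : 0 < Q) (h x y : ℕ) :
    (∑ m ∈ range h, if x / Q ^ (m + 1) = y / Q ^ (m + 1) ∧ x / Q ^ m % Q < y / Q ^ m % Q then a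
      else 0) + (if x / Q ^ h < y / Q ^ h then a else 0) = if x < y then a else 0 := by
  induction h with
  | zero => simp
  | succ h ih =>
    rw [← ih, sum_range_succ, add_assoc]
    congr 1
    rw [pow_succ, ← Nat.div_div_eq_div_mul, ← Nat.div_div_eq_div_mul]
    have hlt := lt_iff_div_lt_or_div_eq_and_mod_lt hQ (x / Q ^ h) (y / Q ^ h)
    rcases lt_trichotomy (x / Q ^ h / Q) (y / Q ^ h / Q) with h' | h' | h'
    · simp [hlt, h', h'.ne]
    · simp [hlt, h']
    · simp [hlt, h'.not_gt, h'.ne']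

theorem sum_ite_digitRev (hQ : 0 < Q) {h x y : ℕ} (hx : x < Q ^ h) (hy : y < Q ^ h) :
    (∑ l ∈ range h, if digitRev Q h x % Q ^ l = digitRev Q h y % Q ^ l ∧
      digitRev Q h x / Q ^ l % Q < digitRev Q h y / Q ^ l % Q then a else 0) =
      if x < y then a else 0 := by
  rw [← sum_ite_digit_lt_add a hQ h x y, Nat.div_eq_of_lt hx, Nat.div_eq_of_lt hy,
    if_neg (lt_irrefl 0), add_zero, ← sum_range_reflect]
  refine sum_congr rfl fun m hm => ?_
  obtain ⟨l, rfl⟩ : ∃ l, h = l + m + 1 := ⟨h - 1 - m, by have := mem_range.1 hm; omega⟩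
  have hlt {z : ℕ} (hz : z < Q ^ (l + m + 1)) : z / Q ^ (m + 1) < Q ^ l :=
    Nat.div_lt_of_lt_mul (by rwa [← pow_add, add_comm, ← add_assoc])
  rw [show l + m + 1 - 1 - m = l by omega, digitRev_div_pow_mod hQ, digitRev_div_pow_mod hQ,
    add_assoc, digitRev_mod_pow hQ, digitRev_mod_pow hQ]
  simp only [(digitRev_injOn Q l).eq_iff (hlt hx) (hlt hy)]

end DigitReversal

section Skip

/-- The target of the jump from distance `d` in the hierarchy of ruler `Q` with `E` levels: a
multiple of `Q ^ j`, `j ≤ E`, is carried to the preceding multiple of `Q ^ j`. -/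
def skip (Q : ℕ) : ℕ → ℕ → ℕ
  | 0, d => d - 1
  | E + 1, d => if Q ∣ d then Q * skip Q E (d / Q) else d - 1

/-- The number of jumps `skip Q E` from `d` down to `0`. -/
def skipCount (Q : ℕ) : ℕ → ℕ → ℕ
  | 0, d => d
  | E + 1, d => d % Q + skipCount Q E (d / Q)

variable {Q : ℕ}

theorem skip_le (Q E d : ℕ) : skip Q E d ≤ d := by
  induction E generalizing d with
  | zero => exact Nat.sub_le d 1
  | succ E ih =>
    rw [skip]
    split_ifs
    · exact (Nat.mul_le_mul_left Q (ih _)).trans (Nat.mul_div_le d Q)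
    · exact Nat.sub_le d 1

theorem skipCount_skip (hQ : 0 < Q) (E d : ℕ) :
    skipCount Q E (skip Q E d) = skipCount Q E d - 1 := by
  induction E generalizing d with
  | zero => rfl
  | succ E ih =>
    rw [skip]
    split_ifs with hd
    · simp only [skipCount, Nat.mul_mod_right, Nat.mul_div_cancel_left _ hQ, ih,
        Nat.mod_eq_zero_of_dvd hd, zero_add]
    · have hpos : 0 < d % Q := Nat.pos_of_ne_zero fun h => hd (Nat.dvd_of_mod_eq_zero h)
      have hdecomp : d - 1 = Q * (d / Q) + (d % Q - 1) := by have := Nat.div_add_mod d Q; omega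
      have hlt : d % Q - 1 < Q := (Nat.sub_le _ 1).trans_lt (Nat.mod_lt d hQ)
      rw [skipCount, skipCount, hdecomp, Nat.mul_add_mod, Nat.mod_eq_of_lt hlt,
        Nat.mul_add_div hQ, Nat.div_eq_of_lt hlt, add_zero]
      exact (Nat.sub_add_comm hpos).symm

theorem eq_zero_of_skipCount_eq_zero (E : ℕ) {d : ℕ} (h : skipCount Q E d = 0) : d = 0 := by
  induction E generalizing d with
  | zero => exact h
  | succ E ih =>
    obtain ⟨hmod, hdiv⟩ := Nat.add_eq_zero_iff.1 h
    rw [← Nat.div_add_mod d Q, ih hdiv, hmod, mul_zero]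

theorem iterate_skip_eq_zero (hQ : 0 < Q) (E : ℕ) {d m : ℕ} (hm : skipCount Q E d ≤ m) :
    (skip Q E)^[m] d = 0 := by
  induction m generalizing d with
  | zero => exact eq_zero_of_skipCount_eq_zero E (Nat.le_zero.1 hm)
  | succ m ih => exact ih (by rw [skipCount_skip hQ]; omega)

theorem skipCount_le (hQ : 0 < Q) (E d : ℕ) : skipCount Q E d ≤ Q * E + d / Q ^ E := by
  induction E generalizing d with
  | zero => simp [skipCount]
  | succ E ih =>
    have hmod := Nat.mod_lt d hQ
    have hdiv := ih (d / Q)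
    rw [Nat.div_div_eq_div_mul, ← pow_succ'] at hdiv
    rw [skipCount, Nat.mul_succ]
    omega

theorem sub_skip_le (hQ : 0 < Q) (E d : ℕ) : d - skip Q E d ≤ Q ^ E := by
  induction E generalizing d with
  | zero => rw [skip, pow_zero]; omega
  | succ E ih =>
    rw [skip]
    split_ifs with hd
    · rw [pow_succ']
      calc d - Q * skip Q E (d / Q)
        _ = Q * (d / Q - skip Q E (d / Q)) := by rw [Nat.mul_sub, Nat.mul_div_cancel' hd]
        _ ≤ Q * Q ^ E := Nat.mul_le_mul_left _ (ih _)
    · have := Nat.pow_pos (n := E + 1) hQ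
      omega

theorem sub_skip_le_sum (hQ : 0 < Q) (E d : ℕ) :
    d - skip Q E d ≤ ∑ j ∈ range (E + 1), if Q ^ j ∣ d then Q ^ j else 0 := by
  induction E generalizing d with
  | zero => simp [skip]; omega
  | succ E ih =>
    rw [skip, sum_range_succ', pow_zero, if_pos (one_dvd d)]
    split_ifs with hd
    · obtain ⟨u, rfl⟩ := hd
      simp only [Nat.mul_div_cancel_left u hQ, pow_succ', Nat.mul_dvd_mul_iff_left hQ]
      calc Q * u - Q * skip Q E u
        _ = Q * (u - skip Q E u) := (Nat.mul_sub _ _ _).symm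
        _ ≤ Q * ∑ j ∈ range (E + 1), if Q ^ j ∣ u then Q ^ j else 0 :=
          Nat.mul_le_mul_left _ (ih u)
        _ = ∑ j ∈ range (E + 1), if Q ^ j ∣ u then Q * Q ^ j else 0 := by
          simp only [mul_sum, mul_ite, mul_zero]
        _ ≤ _ := Nat.le_add_right _ _
    · omega

theorem sum_sub_skip_le (hQ : 0 < Q) (E h : ℕ) :
    ∑ d ∈ Ioc 0 h, (d - skip Q E d) ≤ (E + 1) * h :=
  calc ∑ d ∈ Ioc 0 h, (d - skip Q E d)
    _ ≤ ∑ d ∈ Ioc 0 h, ∑ j ∈ range (E + 1), if Q ^ j ∣ d then Q ^ j else 0 :=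
      sum_le_sum fun d _ => sub_skip_le_sum hQ E d
    _ = ∑ j ∈ range (E + 1), h / Q ^ j * Q ^ j := by
      rw [sum_comm]
      simp only [← sum_filter, sum_const, Nat.Ioc_filter_dvd_card_eq_div, smul_eq_mul]
    _ ≤ ∑ _j ∈ range (E + 1), h := sum_le_sum fun j _ => Nat.div_mul_le_self h (Q ^ j)
    _ = (E + 1) * h := by simp

end Skip

section Bisection

theorem div_two_pow_mul_two_pow (c j : ℕ) :
    c / 2 ^ j * 2 ^ j = if c / 2 ^ (j + 1) * 2 ^ (j + 1) + 2 ^ j ≤ c then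
      c / 2 ^ (j + 1) * 2 ^ (j + 1) + 2 ^ j else c / 2 ^ (j + 1) * 2 ^ (j + 1) := by
  have hpos : 0 < 2 ^ j := by positivity
  have hhalf : c / 2 ^ (j + 1) * 2 ^ (j + 1) = c / 2 ^ j / 2 * 2 * 2 ^ j := by
    rw [pow_succ, ← Nat.div_div_eq_div_mul]
    ring
  simp only [hhalf, ← Nat.succ_mul, ← Nat.le_div_iff_mul_le hpos, ← ite_mul]
  congr 1
  split_ifs <;> omega

end Bisection

section Packing

/-- The word whose base-`b` digits are the `m` numbers `f (j * m)`, …, `f (j * m + m - 1)`. -/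
def packWord (b m : ℕ) (f : ℕ → ℕ) (j : ℕ) : ℕ :=
  Nat.ofDigits b ((List.range m).map fun i => f (j * m + i))

variable {b m : ℕ} {f : ℕ → ℕ}

theorem packWord_lt (hb : 1 < b) (hf : ∀ i, f i < b) (j : ℕ) : packWord b m f j < b ^ m := by
  simpa [packWord] using Nat.ofDigits_lt_base_pow_length (b := b)
    (l := (List.range m).map fun i => f (j * m + i)) hb (by simp [hf])

theorem packWord_div_pow_mod (hm : 0 < m) (hf : ∀ i, f i < b) (i : ℕ) :
    packWord b m f (i / m) / b ^ (i % m) % b = f i := by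
  have hi : i % m < m := Nat.mod_lt i hm
  rw [packWord, Nat.ofDigits_div_pow_eq_ofDigits_drop _ (pos_of_gt (hf 0)) _ (by simp [hf]),
    List.drop_eq_getElem_cons (by simpa using hi), Nat.ofDigits_cons, Nat.add_mul_mod_self_left,
    List.getElem_map, List.getElem_range, Nat.div_add_mod', Nat.mod_eq_of_lt (hf i)]

end Packing

/-! ### The wavelet matrix -/

theorem rectSum_eq_zero_of_lt {r : ℕ} {G : Type*} [AddCommGroup G] (p : Fin r → Fin r × Fin r)
    (v : Fin r → G) {x₁ x₂ y₁ y₂ : Fin r} (h : x₂ < x₁ ∨ y₂ < y₁) : rectSum p v x₁ x₂ y₁ y₂ = 0 :=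
  sum_eq_zero fun q hq => by
    have := (mem_filter.1 hq).2
    omega

/-- The data of a wavelet matrix for `r` weighted points of an `r × r` grid. The columns, with
their base-`2 ^ digitBits` digits reversed, are its strings. -/
structure WaveletIndex (r : ℕ) (G : Type*) where
  point : Fin r → Fin r × Fin r
  value : Fin r → G
  digitBits : ℕ
  two_le : 2 ≤ r
  digitBits_pos : 0 < digitBits
  two_pow_digitBits_le : 2 ^ digitBits ≤ 2 * Nat.size r

namespace WaveletIndex

variable {r : ℕ} {G : Type*} (D : WaveletIndex r G)

section Parameters

/-- The number of bits of `r`. -/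
def bits (_ : WaveletIndex r G) : ℕ := Nat.size r

/-- The base of the digits. -/
def base : ℕ := 2 ^ D.digitBits

/-- The number of digits of a column, hence of levels; level `levels` is the fully sorted one. -/
def levels : ℕ := D.bits / D.digitBits + 1

/-- The number of nontrivial ranks of the jumps between levels; a jump crosses at most half of the
levels. -/
def height : ℕ := Nat.log D.base (D.levels / 2)

/-- The level to which the points of level `l` have jump pointers. -/
def next (l : ℕ) : ℕ := D.levels - skip D.base D.height (D.levels - l)

/-- A number of jumps that lead from every level to the last one. -/
def depth : ℕ := D.base * D.height + D.levels / D.base ^ D.height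

/-- The distance of the sampled positions of a level. -/
def block : ℕ := D.base * D.levels

theorem lt_two_pow_bits : r < 2 ^ D.bits := Nat.lt_size_self r

theorem two_le_bits : 2 ≤ D.bits := Nat.lt_size.2 (by simpa using D.two_le)

theorem two_pow_bits_le : 2 ^ D.bits ≤ 2 * r := by
  have hbits := D.two_le_bits
  have hpred : 2 ^ (D.bits - 1) ≤ r := Nat.lt_size.1 (Nat.sub_lt (by omega) one_pos)
  rw [← Nat.sub_add_cancel (one_le_two.trans hbits), pow_succ']
  omega

theorem base_pos : 0 < D.base := Nat.two_pow_pos _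

theorem two_le_base : 2 ≤ D.base := Nat.le_self_pow D.digitBits_pos.ne' 2

theorem base_le : D.base ≤ 2 * D.bits := D.two_pow_digitBits_le

theorem base_pow (m : ℕ) : D.base ^ m = 2 ^ (D.digitBits * m) := (pow_mul _ _ _).symm

theorem digitBits_le_bits : D.digitBits ≤ D.bits := by
  have hbase := D.base_le
  have hlt : D.digitBits - 1 < 2 ^ (D.digitBits - 1) := Nat.lt_two_pow_self
  rw [base, ← Nat.sub_add_cancel (Nat.one_le_of_lt D.digitBits_pos), pow_succ'] at hbase
  omega

theorem bits_lt_digitBits_mul_levels : D.bits < D.digitBits * D.levels :=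
  Nat.lt_mul_div_succ _ D.digitBits_pos

theorem digitBits_mul_levels_le : D.digitBits * D.levels ≤ D.bits + D.digitBits := by
  rw [levels, Nat.mul_succ]
  exact Nat.add_le_add_right (Nat.mul_div_le _ _) _

theorem two_le_levels : 2 ≤ D.levels :=
  Nat.succ_le_succ (Nat.div_pos D.digitBits_le_bits D.digitBits_pos)

theorem four_le_block : 4 ≤ D.block := Nat.mul_le_mul D.two_le_base D.two_le_levels

theorem bits_le_block : D.bits ≤ D.block :=
  D.bits_lt_digitBits_mul_levels.le.trans (Nat.mul_le_mul_right _ Nat.lt_two_pow_self.le)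

theorem levels_le : D.levels ≤ D.bits + 1 := Nat.succ_le_succ (Nat.div_le_self _ _)

theorem lt_base_pow_levels : r < D.base ^ D.levels := by
  rw [base_pow]
  exact D.lt_two_pow_bits.trans (Nat.pow_lt_pow_right one_lt_two D.bits_lt_digitBits_mul_levels)

theorem base_pow_le {m : ℕ} (hm : m ≤ D.levels) : D.base ^ m ≤ 2 ^ (2 * D.bits) := by
  rw [base_pow]
  refine Nat.pow_le_pow_right two_pos ((Nat.mul_le_mul_left _ hm).trans ?_)
  have := D.digitBits_mul_levels_le
  have := D.digitBits_le_bits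
  omega

theorem two_mul_base_pow_height_le : 2 * D.base ^ D.height ≤ D.levels := by
  have hne : D.levels / 2 ≠ 0 := (Nat.div_pos D.two_le_levels two_pos).ne'
  have hpow : D.base ^ D.height ≤ D.levels / 2 := Nat.pow_log_le_self _ hne
  omega

theorem next_le (l : ℕ) : D.next l ≤ D.levels := Nat.sub_le _ _

theorem le_next {l : ℕ} (hl : l ≤ D.levels) : l ≤ D.next l := by
  have hskip := skip_le D.base D.height (D.levels - l)
  rw [next]
  omega

theorem levels_sub_next (l : ℕ) :
    D.levels - D.next l = skip D.base D.height (D.levels - l) :=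
  Nat.sub_sub_self ((skip_le _ _ _).trans (Nat.sub_le _ _))

theorem iterate_next_le {l : ℕ} (hl : l ≤ D.levels) (m : ℕ) : D.next^[m] l ≤ D.levels := by
  cases m with
  | zero => exact hl
  | succ m => rw [Function.iterate_succ_apply']; exact D.next_le _

theorem iterate_next_depth {l : ℕ} (hl : l ≤ D.levels) : D.next^[D.depth] l = D.levels := by
  have hsemi : Function.Semiconj (D.levels - ·) D.next (skip D.base D.height) := D.levels_sub_next
  have hcount : skipCount D.base D.height (D.levels - l) ≤ D.depth :=
    (skipCount_le D.base_pos _ _).trans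
      (Nat.add_le_add_left (Nat.div_le_div_right (Nat.sub_le _ _)) _)
  have hzero : D.levels - D.next^[D.depth] l = 0 :=
    (hsemi.iterate_right D.depth l).trans (iterate_skip_eq_zero D.base_pos _ hcount)
  exact (D.iterate_next_le hl _).antisymm (Nat.sub_eq_zero_iff_le.1 hzero)

end Parameters

section Order

/-- The reversed column of a point. -/
def revCol (q : Fin r) : ℕ := digitRev D.base D.levels (D.point q).1

/-- The row of a point, made unique by the number of the point. -/
def rowKey (q : Fin r) : ℕ := (D.point q).2 * r + q

/-- The key by which the points of level `l` are sorted. -/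
def levelKey (l : ℕ) (q : Fin r) : ℕ := D.revCol q % D.base ^ l * (r * r) + D.rowKey q

/-- The position of a point on level `l`. -/
def rank (l : ℕ) : Equiv.Perm (Fin r) := keyRank (D.levelKey l)

/-- The digit of a reversed column that belongs to level `l`. -/
def digit (l x : ℕ) : ℕ := x / D.base ^ l % D.base

theorem revCol_lt (q : Fin r) : D.revCol q < D.base ^ D.levels := digitRev_lt D.base_pos _ _

theorem digit_lt (l x : ℕ) : D.digit l x < D.base := Nat.mod_lt _ D.base_pos

theorem rowKey_lt_mul_iff (q : Fin r) (y : ℕ) : D.rowKey q < y * r ↔ (D.point q).2 < y := by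
  simpa [rowKey] using mul_add_lt_mul_add_iff (u := (D.point q).2) (v := y) q.2 r.zero_le

theorem rowKey_lt (q : Fin r) : D.rowKey q < r * r :=
  (D.rowKey_lt_mul_iff q r).2 (D.point q).2.2

theorem rowKey_injective : D.rowKey.Injective := fun q q' h => by
  have hmod := congrArg (· % r) h
  simpa [rowKey, Nat.mod_eq_of_lt, Fin.ext_iff] using hmod

theorem levelKey_mod (l : ℕ) (q : Fin r) : D.levelKey l q % (r * r) = D.rowKey q := by
  rw [levelKey, Nat.mul_add_mod_self_right, Nat.mod_eq_of_lt (D.rowKey_lt q)]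

theorem levelKey_injective (l : ℕ) : (D.levelKey l).Injective := fun q q' h =>
  D.rowKey_injective (by rw [← D.levelKey_mod l, h, D.levelKey_mod])

theorem levelKey_lt (l : ℕ) (q : Fin r) : D.levelKey l q < D.base ^ l * (r * r) := by
  simpa [levelKey, Nat.mod_lt, D.base_pos] using
    mul_add_lt_mul_add_iff (u := D.revCol q % D.base ^ l) (v := D.base ^ l) (D.rowKey_lt q)
      (Nat.zero_le _)

theorem levelKey_add (l m : ℕ) (q : Fin r) : D.levelKey (l + m) q =
    D.revCol q / D.base ^ l % D.base ^ m * (D.base ^ l * (r * r)) + D.levelKey l q := by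
  rw [levelKey, levelKey, pow_add, Nat.mod_mul]
  ring

theorem levelKey_lt_iff (l x : ℕ) {y : ℕ} (hy : y ≤ r) (q : Fin r) :
    D.levelKey l q < x % D.base ^ l * (r * r) + y * r ↔
      D.revCol q % D.base ^ l < x % D.base ^ l ∨
        D.revCol q % D.base ^ l = x % D.base ^ l ∧ (D.point q).2 < y := by
  rw [levelKey, mul_add_lt_mul_add_iff (D.rowKey_lt q) (Nat.mul_le_mul_right r hy),
    rowKey_lt_mul_iff]

end Order

section Jump

/-- The number of bits of a symbol of level `l`. -/
def symbolBits (l : ℕ) : ℕ := D.digitBits * (D.next l - l)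

/-- The digits of a point that are skipped by its jump from level `l`. -/
def symbol (l : ℕ) (q : Fin r) : ℕ := D.revCol q / D.base ^ l % 2 ^ D.symbolBits l

theorem symbol_lt (l : ℕ) (q : Fin r) : D.symbol l q < 2 ^ D.symbolBits l :=
  Nat.mod_lt _ (Nat.two_pow_pos _)

theorem levelKey_next_lt_iff {l : ℕ} (hl : l ≤ D.levels) (q q' : Fin r) :
    D.levelKey (D.next l) q' < D.levelKey (D.next l) q ↔
      D.symbol l q' < D.symbol l q ∨
        D.symbol l q' = D.symbol l q ∧ D.levelKey l q' < D.levelKey l q := by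
  obtain ⟨m, hm⟩ := Nat.exists_eq_add_of_le (D.le_next hl)
  have hsymbol : 2 ^ D.symbolBits l = D.base ^ m := by
    rw [symbolBits, hm, Nat.add_sub_cancel_left, base_pow]
  rw [hm, levelKey_add, levelKey_add,
    mul_add_lt_mul_add_iff (D.levelKey_lt l q') (D.levelKey_lt l q).le, symbol, symbol, hsymbol]

/-- The number of bits by which a block of a jump table exceeds the alphabet; `2 ^ slack` is larger
than the number of levels, so that the tables `bases` of all levels have about `r` words. -/
def slack : ℕ := Nat.clog 2 (D.levels + 1)

/-- The length of the blocks of the jump table of level `l`. -/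
def jumpBlock (l : ℕ) : ℕ := 2 ^ (D.symbolBits l + D.slack)

/-- The number of points of the same symbol that precede a point in its block. -/
def rankInBlock (l : ℕ) (q : Fin r) : ℕ :=
  #{q' | D.symbol l q' = D.symbol l q ∧
    D.rank l q / D.jumpBlock l * D.jumpBlock l ≤ D.rank l q' ∧ D.rank l q' < D.rank l q}

/-- The target of the first point with symbol `c` that is not before block `b`. -/
def jumpBase (l b c : ℕ) : ℕ :=
  #{q | D.symbol l q < c ∨ D.symbol l q = c ∧ D.rank l q < b * D.jumpBlock l}

/-- The code of the jump of a point: its symbol and its rank inside the block. -/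
def jumpEntry (l : ℕ) (q : Fin r) : ℕ := D.symbol l q * D.jumpBlock l + D.rankInBlock l q

/-- The number of bits of the code of a jump. -/
def entryBits (l : ℕ) : ℕ := 2 * D.symbolBits l + D.slack

theorem jumpBlock_pos (l : ℕ) : 0 < D.jumpBlock l := Nat.two_pow_pos _

theorem rankInBlock_lt (l : ℕ) (q : Fin r) : D.rankInBlock l q < D.jumpBlock l := by
  refine (card_keyRank_Ico_le _ _ _ _).trans_lt ?_
  have hmod := Nat.mod_lt (D.rank l q) (D.jumpBlock_pos l)
  have hdecomp := Nat.div_add_mod' (D.rank l q) (D.jumpBlock l)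
  have : keyRank (D.levelKey l) q = D.rank l q := rfl
  omega

theorem rank_next {l : ℕ} (hl : l ≤ D.levels) (q : Fin r) : (D.rank (D.next l) q : ℕ) =
    D.jumpBase l (D.rank l q / D.jumpBlock l) (D.symbol l q) + D.rankInBlock l q :=
  keyRank_eq_add_of_lex (D.levelKey_injective l) (D.levelKey_injective _)
    (D.levelKey_next_lt_iff hl) (Nat.div_mul_le_self _ _)

theorem jumpEntry_div (l : ℕ) (q : Fin r) : D.jumpEntry l q / D.jumpBlock l = D.symbol l q := by
  rw [jumpEntry, mul_comm, Nat.mul_add_div (D.jumpBlock_pos l),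
    Nat.div_eq_of_lt (D.rankInBlock_lt l q), add_zero]

theorem jumpEntry_mod (l : ℕ) (q : Fin r) :
    D.jumpEntry l q % D.jumpBlock l = D.rankInBlock l q := by
  rw [jumpEntry, Nat.mul_add_mod_self_right, Nat.mod_eq_of_lt (D.rankInBlock_lt l q)]

theorem jumpEntry_lt (l : ℕ) (q : Fin r) : D.jumpEntry l q < 2 ^ D.entryBits l := by
  have hpow : 2 ^ D.entryBits l = 2 ^ D.symbolBits l * D.jumpBlock l := by
    rw [jumpBlock, entryBits, ← pow_add]
    ring_nf
  rw [hpow]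
  simpa [jumpEntry, D.symbol_lt] using
    mul_add_lt_mul_add_iff (u := D.symbol l q) (v := 2 ^ D.symbolBits l) (D.rankInBlock_lt l q)
      (Nat.zero_le _)

end Jump

section Sums

variable [AddCommGroup G]

/-- The sum of the values of those of the first `c` points of level `l` whose digit is below `g`. -/
def prefixSum (l g c : ℕ) : G :=
  ∑ q with D.rank l q < c ∧ D.digit l (D.revCol q) < g, D.value q

/-- The contribution of level `l` to `cornerSum`: that of the points whose column first differs
from the column with reversal `x` in the digit of level `l`. -/
def levelSum (x y l : ℕ) : G :=
  ∑ q with D.levelKey l q < x % D.base ^ l * (r * r) + y ∧ D.digit l (D.revCol q) < D.digit l x,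
    D.value q

/-- A sum whose increments in `y` are the sums over the points to the left of column `x` in a strip
of rows. -/
def cornerSum (x y : ℕ) : G :=
  ∑ l ∈ range D.levels, D.levelSum (digitRev D.base D.levels x) (y * r) l

theorem prefixSum_rank_succ (l g : ℕ) (q : Fin r) : D.prefixSum l g (D.rank l q + 1) =
    D.prefixSum l g (D.rank l q) + if D.digit l (D.revCol q) < g then D.value q else 0 := by
  have hlt (q' : Fin r) :
      (D.rank l q' : ℕ) < D.rank l q + 1 ↔ D.rank l q' < D.rank l q ∨ q' = q := by
    rw [Nat.lt_succ_iff_lt_or_eq, Fin.val_inj, (D.rank l).apply_eq_iff_eq, Fin.lt_def]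
  rw [prefixSum, prefixSum, sum_filter, sum_filter,
    ← Fintype.sum_ite_eq' q fun q' => if D.digit l (D.revCol q') < g then D.value q' else 0,
    ← sum_add_distrib]
  refine sum_congr rfl fun q' _ => ?_
  rcases eq_or_ne q' q with rfl | hne
  · simp
  · simp [hlt, hne]

theorem levelSum_eq_prefixSum (x y l : ℕ) : D.levelSum x y l =
    D.prefixSum l (D.digit l x) #{q | D.levelKey l q < x % D.base ^ l * (r * r) + y} := by
  simp only [levelSum, prefixSum, rank, keyRank_lt_card_iff (D.levelKey_injective l)]

theorem levelSum_sub (l x : ℕ) {y y' : ℕ} (hy : y ≤ r) (hyy : y' ≤ y) :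
    D.levelSum x (y * r) l - D.levelSum x (y' * r) l =
      ∑ q with y' ≤ (D.point q).2 ∧ (D.point q).2 < y,
        if D.revCol q % D.base ^ l = x % D.base ^ l ∧ D.digit l (D.revCol q) < D.digit l x
          then D.value q else 0 := by
  simp only [levelSum, sum_filter, ← sum_sub_distrib, D.levelKey_lt_iff l x hy,
    D.levelKey_lt_iff l x (hyy.trans hy)]
  refine sum_congr rfl fun q _ => ?_
  split_ifs <;> first | omega | simp

theorem cornerSum_sub {x y y' : ℕ} (hx : x ≤ r) (hy : y ≤ r) (hyy : y' ≤ y) :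
    D.cornerSum x y - D.cornerSum x y' =
      ∑ q with y' ≤ (D.point q).2 ∧ (D.point q).2 < y,
        if (D.point q).1 < x then D.value q else 0 := by
  rw [cornerSum, cornerSum, ← sum_sub_distrib]
  simp only [D.levelSum_sub _ _ hy hyy]
  rw [sum_comm]
  exact sum_congr rfl fun q _ => sum_ite_digitRev (D.value q) D.base_pos
    ((D.point q).1.2.trans D.lt_base_pow_levels) (hx.trans_lt D.lt_base_pow_levels)

theorem rectSum_eq_cornerSum {x₁ x₂ y₁ y₂ : Fin r} (hx : x₁ ≤ x₂) (hy : y₁ ≤ y₂) :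
    rectSum D.point D.value x₁ x₂ y₁ y₂ =
      D.cornerSum (x₂ + 1) (y₂ + 1) - D.cornerSum (x₂ + 1) y₁ -
        (D.cornerSum x₁ (y₂ + 1) - D.cornerSum x₁ y₁) := by
  rw [D.cornerSum_sub (Nat.succ_le_of_lt x₂.2) (Nat.succ_le_of_lt y₂.2) (by grind),
    D.cornerSum_sub x₁.2.le (Nat.succ_le_of_lt y₂.2) (by grind), ← sum_sub_distrib, sum_filter,
    rectSum, sum_filter]
  refine sum_congr rfl fun q _ => ?_
  split_ifs <;> first | omega | simp

end Sums

end WaveletIndex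

/-- The `m × n` table of the values of `f`, row by row. -/
def table (m n : ℕ) (f : ℕ → ℕ → ℕ) : List ℕ := (List.range (m * n)).map fun k => f (k / n) (k % n)

theorem length_table (m n : ℕ) (f : ℕ → ℕ → ℕ) : (table m n f).length = m * n := by simp [table]

theorem getElem?_table {m n i j : ℕ} (f : ℕ → ℕ → ℕ) (hi : i < m) (hj : j < n) :
    (table m n f)[i * n + j]? = some (f i j) := by
  have hlt : i * n + j < m * n := by
    simpa [hi] using mul_add_lt_mul_add_iff (u := i) (v := m) hj n.zero_le
  have hdiv : (i * n + j) / n = i := by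
    rw [mul_comm, Nat.mul_add_div (j.zero_le.trans_lt hj), Nat.div_eq_of_lt hj, add_zero]
  simp [table, hlt, hdiv, Nat.mod_eq_of_lt hj]

namespace WaveletIndex

variable {r : ℕ} {G : Type*} (D : WaveletIndex r G)

section Memory

variable [AddCommGroup G] {N : ℕ} (code : G ≃ Fin N)

/-- The values of a function of the points, in the order of the points on level `l`. -/
def byRank (l : ℕ) (f : Fin r → ℕ) : List ℕ := List.ofFn fun i => f ((D.rank l).symm i)

/-- The number of codes of jumps that are packed into a word. -/
def perWord (l : ℕ) : ℕ := 4 * D.bits / D.entryBits l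

/-- The parameters that the query program reads; `2 ^ (bits - 1)` is the first step size of the
binary searches. -/
def scalars : List ℕ :=
  [r, D.levels, D.base, D.depth, D.block, 2 ^ (D.bits - 1), D.bits]

/-- The parameters of level `l`. -/
def levelScalars (l : ℕ) : List ℕ :=
  [D.next l, D.perWord l, D.entryBits l, 2 ^ D.entryBits l, D.jumpBlock l, 2 ^ D.symbolBits l,
    D.base ^ l]

/-- The packed codes of the jumps from level `l`. -/
def items (l : ℕ) : List ℕ :=
  (List.range (r / D.perWord l + 1)).map
    (packWord (2 ^ D.entryBits l) (D.perWord l) fun i => (D.byRank l (D.jumpEntry l)).getD i 0)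

/-- The numbers `jumpBase l b c` for all blocks `b` and all symbols `c`. -/
def bases (l : ℕ) : List ℕ :=
  table (r / D.jumpBlock l + 1) (2 ^ D.symbolBits l) (D.jumpBase l)

/-- The sums `prefixSum l g c` for all multiples `c` of `block` and all digits `g`. -/
def samples (l : ℕ) : List ℕ :=
  table (r / D.block + 1) D.base fun b g => code (D.prefixSum l g (b * D.block))

/-- The segments of level `l`. -/
def levelDirectory (l : ℕ) : ℕ → List ℕ
  | 0 => D.levelScalars l
  | 1 => D.items l
  | 2 => D.bases l
  | _ => D.samples code l

/-- The segments of the memory; the points are listed in the order of the last level. -/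
def directory : ℕ → List ℕ
  | 0 => D.scalars
  | 1 => D.byRank D.levels D.revCol
  | 2 => D.byRank D.levels D.rowKey
  | 3 => D.byRank D.levels fun q => code (D.value q)
  | 4 => (List.range (r + 1)).map (digitRev D.base D.levels)
  | j + 5 => D.levelDirectory code (j / 4) (j % 4)

/-- The number of segments. -/
def segments : ℕ := 4 * (D.levels + 1) + 5

omit [AddCommGroup G] in
theorem getElem?_byRank (l : ℕ) (f : Fin r → ℕ) (q : Fin r) :
    (D.byRank l f)[(D.rank l q : ℕ)]? = some (f q) := by
  simp [byRank]

omit [AddCommGroup G] in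
theorem forall_mem_byRank {M : ℕ} (l : ℕ) {f : Fin r → ℕ} (hf : ∀ q, f q < M) :
    ∀ x ∈ D.byRank l f, x < M := by
  simp [byRank, hf]

end Memory

section Bounds

theorem two_mul_symbolBits_le (l : ℕ) : 2 * D.symbolBits l ≤ D.bits + D.digitBits := by
  have hjump : D.next l - l ≤ D.base ^ D.height := by
    have := sub_skip_le D.base_pos D.height (D.levels - l)
    rw [next]
    omega
  rw [symbolBits, Nat.mul_left_comm]
  exact (Nat.mul_le_mul_left _ ((Nat.mul_le_mul_left 2 hjump).trans
    D.two_mul_base_pow_height_le)).trans D.digitBits_mul_levels_le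

theorem symbolBits_le (l : ℕ) : D.symbolBits l ≤ D.bits := by
  have := D.two_mul_symbolBits_le l
  have := D.digitBits_le_bits
  omega

theorem slack_le : D.slack ≤ D.bits := by
  refine Nat.clog_le_of_le_pow ((Nat.succ_le_succ D.levels_le).trans ?_)
  have hlt : D.bits - 1 < 2 ^ (D.bits - 1) := Nat.lt_two_pow_self
  have := D.two_le_bits
  rw [← Nat.sub_add_cancel (one_le_two.trans D.two_le_bits), pow_succ']
  omega

theorem slack_pos : 0 < D.slack := Nat.clog_pos one_lt_two (by have := D.two_le_levels; omega)

theorem entryBits_pos (l : ℕ) : 0 < D.entryBits l := Nat.add_pos_right _ D.slack_pos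

theorem entryBits_le (l : ℕ) : D.entryBits l ≤ 3 * D.bits := by
  have := D.symbolBits_le l
  have := D.slack_le
  rw [entryBits]
  omega

theorem perWord_pos (l : ℕ) : 0 < D.perWord l :=
  Nat.div_pos ((D.entryBits_le l).trans (by omega)) (D.entryBits_pos l)

theorem getD_jumpEntry_lt (l i : ℕ) :
    (D.byRank l (D.jumpEntry l)).getD i 0 < 2 ^ D.entryBits l := by
  rw [List.getD_eq_getElem?_getD]
  rcases h : (D.byRank l (D.jumpEntry l))[i]? with _ | x
  · exact Nat.two_pow_pos _
  · exact D.forall_mem_byRank l (D.jumpEntry_lt l) x (List.mem_of_getElem? h)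

theorem height_lt : D.height < D.levels :=
  (Nat.log_le_self _ _).trans_lt (Nat.div_lt_self (by have := D.two_le_levels; omega) one_lt_two)

theorem depth_le : D.depth ≤ D.base * (D.height + 3) := by
  have hlog : D.levels / 2 < D.base ^ (D.height + 1) :=
    Nat.lt_pow_succ_log_self D.two_le_base _
  have hpow : 0 < D.base ^ D.height := Nat.pow_pos D.base_pos
  have hdiv : D.levels / D.base ^ D.height ≤ D.base * 3 := by
    refine Nat.div_le_of_le_mul ?_
    rw [pow_succ] at hlog
    nlinarith [Nat.mul_le_mul hpow D.base_pos, Nat.div_add_mod D.levels 2,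
      Nat.mod_lt D.levels two_pos]
  rw [depth, mul_add]
  exact Nat.add_le_add_left hdiv _

theorem depth_pos : 0 < D.depth := by
  have := D.two_mul_base_pow_height_le
  exact Nat.add_pos_right _ (Nat.div_pos (by omega) (Nat.pow_pos D.base_pos))

theorem block_le : D.block ≤ 5 * D.bits ^ 2 := by
  have := Nat.mul_le_mul D.base_le D.levels_le
  rw [block]
  nlinarith [D.two_le_bits]

theorem depth_le_sq_bits : D.depth ≤ 5 * D.bits ^ 2 := by
  have hheight : D.height + 3 ≤ D.bits + 3 := by
    have := D.height_lt
    have := D.levels_le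
    omega
  have := D.depth_le.trans (Nat.mul_le_mul D.base_le hheight)
  nlinarith [D.two_le_bits]

theorem sixteen_mul_sq_bits_lt : 16 * D.bits ^ 2 < 2 ^ (4 * D.bits) := by
  have hlt : D.bits < 2 ^ D.bits := Nat.lt_two_pow_self
  have hfour : 2 ^ 2 ≤ 2 ^ D.bits := Nat.pow_le_pow_right two_pos D.two_le_bits
  calc 16 * D.bits ^ 2 < (2 ^ 2) ^ 2 * (2 ^ D.bits) ^ 2 := by
        have := Nat.pow_lt_pow_left hlt two_ne_zero
        omega
    _ ≤ (2 ^ D.bits) ^ 2 * (2 ^ D.bits) ^ 2 :=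
        Nat.mul_le_mul_right _ (Nat.pow_le_pow_left hfour 2)
    _ = 2 ^ (4 * D.bits) := by ring

theorem mul_self_le : r * r ≤ 2 ^ (4 * D.bits) := by
  refine (Nat.mul_le_mul D.lt_two_pow_bits.le D.lt_two_pow_bits.le).trans ?_
  rw [← pow_add]
  exact Nat.pow_le_pow_right two_pos (by omega)

end Bounds

section WordBounds

variable [AddCommGroup G] {N M : ℕ} (code : G ≃ Fin N)

omit [AddCommGroup G] in
theorem scalars_lt (hM : 2 ^ (4 * D.bits) ≤ M) : ∀ x ∈ D.scalars, x < M := by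
  have hsq := D.sixteen_mul_sq_bits_lt
  have hbits := D.two_le_bits
  have hbits_sq := Nat.le_self_pow two_ne_zero D.bits
  have hr : 2 ^ D.bits < 2 ^ (4 * D.bits) := Nat.pow_lt_pow_right one_lt_two (by omega)
  have hhalf : 2 ^ (D.bits - 1) ≤ 2 ^ D.bits := Nat.pow_le_pow_right two_pos (Nat.sub_le _ _)
  simp only [scalars, List.forall_mem_cons, List.not_mem_nil, false_imp_iff, implies_true, and_true]
  have := D.lt_two_pow_bits
  have := D.levels_le
  have := D.base_le
  have := D.depth_le_sq_bits
  have := D.block_le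
  omega

omit [AddCommGroup G] in
theorem levelScalars_lt (hM : 2 ^ (4 * D.bits) ≤ M) {l : ℕ} (hl : l ≤ D.levels) :
    ∀ x ∈ D.levelScalars l, x < M := by
  have hbits := D.two_le_bits
  have hpow {e : ℕ} (he : e ≤ 3 * D.bits) : 2 ^ e < M :=
    (Nat.pow_lt_pow_right one_lt_two (by omega)).trans_le hM
  have hbase : D.base ^ l < M := (D.base_pow_le hl).trans_lt (hpow (by omega))
  have hentry := D.entryBits_le l
  have hperWord : D.perWord l ≤ 4 * D.bits := Nat.div_le_self _ _
  have hsq := D.sixteen_mul_sq_bits_lt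
  have hbits_sq := Nat.le_self_pow two_ne_zero D.bits
  have := D.next_le l
  have := D.levels_le
  have := D.symbolBits_le l
  have := D.slack_le
  simp only [levelScalars, List.forall_mem_cons, List.not_mem_nil, false_imp_iff, implies_true,
    and_true]
  exact ⟨by omega, by omega, by omega, hpow hentry, hpow (by omega), hpow (by omega), hbase⟩

omit [AddCommGroup G] in
theorem items_lt (hM : 2 ^ (4 * D.bits) ≤ M) (l : ℕ) : ∀ x ∈ D.items l, x < M := by
  have hword : (2 ^ D.entryBits l) ^ D.perWord l ≤ M := by
    rw [← pow_mul]
    exact (Nat.pow_le_pow_right two_pos (Nat.mul_div_le _ _)).trans hM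
  simp only [items, List.forall_mem_map]
  exact fun j _ => (packWord_lt (Nat.one_lt_two_pow (D.entryBits_pos l).ne')
    (D.getD_jumpEntry_lt l) j).trans_le hword

theorem levelDirectory_lt (hM : 2 ^ (4 * D.bits) ≤ M) (hN : N ≤ M) {l : ℕ} (hl : l ≤ D.levels) :
    ∀ k, ∀ x ∈ D.levelDirectory code l k, x < M
  | 0 => D.levelScalars_lt hM hl
  | 1 => D.items_lt hM l
  | 2 => by
    have hr : r < M := D.lt_two_pow_bits.trans_le
      ((Nat.pow_le_pow_right two_pos (by omega)).trans hM)
    simp only [levelDirectory, bases, table, List.forall_mem_map]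
    exact fun k _ => ((card_le_univ _).trans_eq (Fintype.card_fin r)).trans_lt hr
  | k + 3 => by
    simp only [levelDirectory, samples, table, List.forall_mem_map]
    exact fun k _ => (code _).2.trans_le hN

theorem directory_lt (hM : 2 ^ (4 * D.bits) ≤ M) (hN : N ≤ M) :
    ∀ j < D.segments, ∀ x ∈ D.directory code j, x < M := by
  have hpow : D.base ^ D.levels ≤ M := (D.base_pow_le le_rfl).trans
    ((Nat.pow_le_pow_right two_pos (by omega)).trans hM)
  intro j hj
  match j with
  | 0 => exact D.scalars_lt hM
  | 1 => exact D.forall_mem_byRank _ fun q => (D.revCol_lt q).trans_le hpow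
  | 2 => exact D.forall_mem_byRank _ fun q => (D.rowKey_lt q).trans_le (D.mul_self_le.trans hM)
  | 3 => exact D.forall_mem_byRank _ fun q => (code _).2.trans_le hN
  | 4 =>
    simp only [directory, List.forall_mem_map]
    exact fun x _ => (digitRev_lt D.base_pos _ x).trans_le hpow
  | j + 5 => exact D.levelDirectory_lt code hM hN (by rw [segments] at hj; omega) _

end WordBounds

section Segments

variable [AddCommGroup G] {N : ℕ} (code : G ≃ Fin N)

omit [AddCommGroup G] in
theorem exists_getElem?_items (l : ℕ) (q : Fin r) :
    ∃ x, (D.items l)[D.rank l q / D.perWord l]? = some x ∧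
      x / 2 ^ (D.entryBits l * (D.rank l q % D.perWord l)) % 2 ^ D.entryBits l =
        D.jumpEntry l q := by
  have hlt : D.rank l q / D.perWord l < r / D.perWord l + 1 :=
    Nat.lt_succ_of_le (Nat.div_le_div_right (D.rank l q).2.le)
  refine ⟨_, by rw [items, List.getElem?_map, List.getElem?_range hlt]; rfl, ?_⟩
  rw [pow_mul, packWord_div_pow_mod (D.perWord_pos l) (D.getD_jumpEntry_lt l),
    List.getD_eq_getElem?_getD, getElem?_byRank, Option.getD_some]

omit [AddCommGroup G] in
theorem getElem?_bases (l : ℕ) (q : Fin r) :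
    (D.bases l)[D.rank l q / D.jumpBlock l * 2 ^ D.symbolBits l + D.symbol l q]? =
      some (D.jumpBase l (D.rank l q / D.jumpBlock l) (D.symbol l q)) :=
  getElem?_table _ (Nat.lt_succ_of_le (Nat.div_le_div_right (D.rank l q).2.le)) (D.symbol_lt l q)

theorem getElem?_samples {l g c : ℕ} (hg : g < D.base) (hc : c ≤ r) :
    (D.samples code l)[c / D.block * D.base + g]? =
      some (code (D.prefixSum l g (c / D.block * D.block)) : ℕ) :=
  getElem?_table (fun b g => (code (D.prefixSum l g (b * D.block)) : ℕ))
    (Nat.lt_succ_of_le (Nat.div_le_div_right hc)) hg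

end Segments

end WaveletIndex

/-! ### The query program -/

namespace WordRAM.Code

/-- A parameter of the data structure. -/
def scalar (k : ℕ) : Code := segment 0 (lit k)

/-- The number of points. -/
def size : Code := scalar 0

/-- A word of the `k`-th segment of level `l`. -/
def levelSegment (l : Code) (k : ℕ) (i : Code) : Code := segment (4 * l + lit (k + 5)) i

/-- A parameter of level `l`. -/
def levelScalar (l : Code) (k : ℕ) : Code := levelSegment l 0 (lit k)

/-- The code of the jump of the point at position `i` of level `l`. -/
def entry (l i : Code) : Code :=
  levelSegment l 1 (i / levelScalar l 1) >>> (levelScalar l 2 * (i % levelScalar l 1)) %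
    levelScalar l 3

/-- The position on level `next l` of the point at position `i` of level `l`, when `e` is the code
of its jump. -/
def target (l i e : Code) : Code :=
  levelSegment l 2 (i / levelScalar l 4 * levelScalar l 5 + e / levelScalar l 4) +
    e % levelScalar l 4

/-- The position after the jump of the point at `node`, where position `i` of level `l` is written
as `l * size + i`. -/
def jump (node : Code) : Code :=
  letE (node / size) fun l => letE (node % size) fun i =>
  letE (entry l i) fun e =>
  levelScalar l 0 * size + target l i e

/-- The position on the last level of the point at position `i` of level `l`. -/
def position (l i : Code) : Code :=
  forLoop (scalar 3) (l * size + i) (fun node _ => jump node) % size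

/-- The key on level `l` of a point with reversed column `x` and row key `y`. -/
def key (l x y : Code) : Code := x % levelScalar l 6 * (size * size) + y

/-- The digit of `x` that belongs to level `l`. -/
def digit (l x : Code) : Code := x / levelScalar l 6 % scalar 2

/-- One step of the binary search of `search`, which replaces the lower bound `c` by `m` if at least
`m` points have a key below `t`. -/
def probe (l t c m : Code) : Code :=
  iteLt size m c <| letE (position l (m - 1)) fun z =>
  iteLt (key l (segment 1 z) (segment 2 z)) t m c

/-- The number of points whose key on level `l` is less than `t`. -/
def search (l t : Code) : Code :=
  forLoop (scalar 6) 0 fun c i => letE (c + scalar 5 >>> i) fun m => probe l t c m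

/-- One step of `scan`, which adds to `s` the value of the point at position `i` of level `l` if its
digit is below `g`. -/
def scanStep (l g i s : Code) : Code :=
  letE (position l i) fun z => iteLt (digit l (segment 1 z)) g (gadd s (segment 3 z)) s

/-- The sum of the values of those of the first `c` points of level `l` whose digit is below `g`. -/
def scan (l g c : Code) : Code :=
  forLoop (c % scalar 4) (levelSegment l 3 (c / scalar 4 * scalar 2 + g)) fun s j =>
  scanStep l g (c - c % scalar 4 + j) s

/-- The contribution of level `l` to `cornerSum`. -/
def levelSum (x y l : Code) : Code :=
  letE (key l x y) fun t => letE (search l t) fun c => letE (digit l x) fun g => scan l g c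

/-- The value of `WaveletIndex.cornerSum`. -/
def cornerSum (x y : Code) : Code :=
  letE (segment 4 x) fun x' => letE (y * size) fun y' =>
  forLoop (scalar 1) gzero fun s l => gadd s (levelSum x' y' l)

/-- The sum over a rectangle. -/
def rectangle (x₁ x₂ y₁ y₂ : Code) : Code :=
  iteLt x₂ x₁ gzero <| iteLt y₂ y₁ gzero <|
  gadd (gadd (cornerSum (x₂ + 1) (y₂ + 1)) (gneg (cornerSum (x₂ + 1) y₁)))
    (gneg (gadd (cornerSum x₁ (y₂ + 1)) (gneg (cornerSum x₁ y₁))))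

/-- The query program. -/
def query : Prog :=
  .seq (rectangle (reg 0) (reg 1) (reg 2) (reg 3) 4) (move 0 4)

end WordRAM.Code

namespace WaveletIndex

open WordRAM

variable {r w N : ℕ} {G : Type*} [AddCommGroup G] {mem : List (BitVec w)} {code : G ≃ Fin N}
  {D : WaveletIndex r G}

/-- The memory `mem` holds the segments of `D`, and words are long enough for the numbers that occur
in a query. -/
structure IsStored (mem : List (BitVec w)) (code : G ≃ Fin N) (D : WaveletIndex r G) : Prop where
  storesSegments : StoresSegments mem (D.directory code) D.segments
  card_le : N ≤ 2 ^ w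
  bits_le : 16 * D.bits ≤ w

theorem directory_level (l : ℕ) {k : ℕ} (hk : k < 4) :
    D.directory code (4 * l + (k + 5)) = D.levelDirectory code l k := by
  rw [← add_assoc, directory, Nat.mul_add_div four_pos, Nat.div_eq_of_lt hk, add_zero,
    Nat.mul_add_mod, Nat.mod_eq_of_lt hk]

omit [AddCommGroup G] in
theorem scalar_le {k x : ℕ} (hx : D.scalars[k]? = some x) : x ≤ 2 ^ (4 * D.bits) :=
  (D.scalars_lt le_rfl x (List.mem_of_getElem? hx)).le

omit [AddCommGroup G] in
theorem levelScalar_le {l k x : ℕ} (hl : l ≤ D.levels) (hx : (D.levelScalars l)[k]? = some x) :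
    x ≤ 2 ^ (4 * D.bits) :=
  (D.levelScalars_lt le_rfl hl x (List.mem_of_getElem? hx)).le

omit [AddCommGroup G] in
theorem sixteen_le : 16 ≤ 2 ^ (4 * D.bits) :=
  Nat.pow_le_pow_right (i := 4) two_pos (by have := D.two_le_bits; omega)

namespace IsStored

variable (hD : D.IsStored mem code) {F : Frame w}
include hD

theorem mul_add_lt {x y z : ℕ} (hx : x ≤ 2 ^ (4 * D.bits)) (hy : y ≤ 2 ^ (4 * D.bits))
    (hz : z ≤ 2 ^ (4 * D.bits)) : x * y + z < 2 ^ w := by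
  have hbits := D.two_le_bits
  calc x * y + z ≤ 2 ^ (4 * D.bits) * 2 ^ (4 * D.bits) + 2 ^ (4 * D.bits) * 2 ^ (4 * D.bits) := by
        refine Nat.add_le_add (Nat.mul_le_mul hx hy) (hz.trans ?_)
        exact Nat.le_mul_of_pos_right _ (Nat.two_pow_pos _)
    _ = 2 ^ (8 * D.bits + 1) := by ring
    _ < 2 ^ w := Nat.pow_lt_pow_right one_lt_two (by have := hD.bits_le; omega)

theorem lt_two_pow {x : ℕ} (hx : x ≤ 2 ^ (4 * D.bits)) : x < 2 ^ w := by
  simpa using hD.mul_add_lt (Nat.zero_le _) (Nat.zero_le _) hx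

theorem mul_add {a b c : Code} {x y z T₁ T₂ T₃ : ℕ} (ha : Computes mem code F a x T₁)
    (hb : Computes mem code F b y T₂) (hc : Computes mem code F c z T₃)
    (hx : x ≤ 2 ^ (4 * D.bits)) (hy : y ≤ 2 ^ (4 * D.bits)) (hz : z ≤ 2 ^ (4 * D.bits)) :
    Computes mem code F (a * b + c) (x * y + z) (T₁ + T₂ + T₃ + 2) := by
  have hlt := hD.mul_add_lt hx hy hz
  exact ((ha.mul hb (by omega)).add hc hlt).of_eq_of_le rfl (by omega)

theorem lit {k : ℕ} (hk : k ≤ 16) : Computes mem code F (.lit k) k 1 :=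
  .lit (hD.lt_two_pow (hk.trans D.sixteen_le))

theorem segment {b : Code} {i x T : ℕ} (j : ℕ) (hj : j < 5) (hb : Computes mem code F b i T)
    (hx : (D.directory code j)[i]? = some x) :
    Computes mem code F (.segment (.lit j) b) x (T + 4) :=
  ((hD.lit (by omega)).segment hD.storesSegments hb (by rw [segments]; omega) hx).of_eq_of_le rfl
    (by omega)

theorem scalar {x : ℕ} (k : ℕ) (hx : D.scalars[k]? = some x) :
    Computes mem code F (.scalar k) x 5 := by
  have hk : k < 7 := (List.getElem?_eq_some_iff.1 hx).1
  exact hD.segment 0 (by omega) (hD.lit (by omega)) hx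

theorem size : Computes mem code F .size r 5 := hD.scalar 0 rfl

theorem levelSegment {a b : Code} {l i x T : ℕ} (hl : l ≤ D.levels) (k : ℕ) (hk : k < 4)
    (ha : Computes mem code F a l 2) (hb : Computes mem code F b i T)
    (hx : (D.levelDirectory code l k)[i]? = some x) :
    Computes mem code F (.levelSegment a k b) x (T + 9) := by
  have hlevel : l ≤ 2 ^ (4 * D.bits) := hl.trans (D.scalar_le (k := 1) rfl)
  have hsixteen := D.sixteen_le
  have hsegment : Computes mem code F (.lit 4 * a + .lit (k + 5)) (4 * l + (k + 5)) 6 :=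
    hD.mul_add (hD.lit (by omega)) ha (hD.lit (by omega)) (by omega) hlevel (by omega)
  exact (hsegment.segment hD.storesSegments hb (by rw [segments]; omega)
    (by rwa [directory_level l hk])).of_eq_of_le rfl (by omega)

theorem levelScalar {a : Code} {l x : ℕ} (hl : l ≤ D.levels) (ha : Computes mem code F a l 2)
    (k : ℕ) (hx : (D.levelScalars l)[k]? = some x) :
    Computes mem code F (.levelScalar a k) x 10 := by
  have hk : k < 7 := (List.getElem?_eq_some_iff.1 hx).1
  exact hD.levelSegment hl 0 four_pos ha (hD.lit (by omega)) hx

theorem entry {a b : Code} {l : ℕ} (hl : l ≤ D.levels) (q : Fin r)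
    (ha : Computes mem code F a l 2) (hb : Computes mem code F b (D.rank l q) 2) :
    Computes mem code F (.entry a b) (D.jumpEntry l q) 58 := by
  obtain ⟨x, hx, hentry⟩ := D.exists_getElem?_items l q
  have hperWord := hD.levelScalar (F := F) hl ha 1 rfl
  have hitem := hD.levelSegment hl 1 (by omega) ha (hb.div hperWord) hx
  have hmod : D.rank l q % D.perWord l ≤ 2 ^ (4 * D.bits) :=
    (Nat.mod_le _ _).trans ((D.rank l q).2.le.trans (D.scalar_le (k := 0) rfl))
  have hshift := (hD.levelScalar hl ha 2 rfl).mul (hb.mod hperWord)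
    (hD.mul_add_lt (z := 0) (D.levelScalar_le (k := 2) hl rfl) hmod (Nat.zero_le _))
  exact ((hitem.shiftRight hshift).mod (hD.levelScalar hl ha 3 rfl)).of_eq_of_le hentry (by omega)

theorem target {a b e : Code} {l : ℕ} (hl : l ≤ D.levels) (q : Fin r)
    (ha : Computes mem code F a l 2) (hb : Computes mem code F b (D.rank l q) 2)
    (he : Computes mem code F e (D.jumpEntry l q) 2) :
    Computes mem code F (.target a b e) (D.rank (D.next l) q) 61 := by
  have hr : r ≤ 2 ^ (4 * D.bits) := D.scalar_le (k := 0) rfl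
  have hrank := (D.rank l q).2
  have hsymbols := D.levelScalar_le (k := 5) hl rfl
  have hblock := hD.levelScalar (F := F) hl ha 4 rfl
  have hsymbol := (he.div hblock).of_eq_of_le (D.jumpEntry_div l q) le_rfl
  have hrow := hD.mul_add (hb.div hblock) (hD.levelScalar hl ha 5 rfl) hsymbol
    ((Nat.div_le_self _ _).trans (by omega)) hsymbols ((D.symbol_lt l q).le.trans hsymbols)
  have hbase := hD.levelSegment hl 2 (by omega) ha hrow (D.getElem?_bases l q)
  have hnext := (D.rank (D.next l) q).2
  have hlt := hD.lt_two_pow hr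
  have hrank_next := D.rank_next hl q
  exact (hbase.add ((he.mod hblock).of_eq_of_le (D.jumpEntry_mod l q) le_rfl)
    (by omega)).of_eq_of_le hrank_next.symm (by omega)

theorem jump {u : Code} {l : ℕ} (hl : l ≤ D.levels) (q : Fin r)
    (hu : Computes mem code F u (l * r + D.rank l q) 2) :
    Computes mem code F (.jump u) (D.next l * r + D.rank (D.next l) q) 158 := by
  have hrank := (D.rank l q).2
  have hr : r ≤ 2 ^ (4 * D.bits) := D.scalar_le (k := 0) rfl
  have hdiv := (hu.div hD.size).of_eq_of_le
    (y := l) (by rw [mul_comm, Nat.mul_add_div q.pos, Nat.div_eq_of_lt hrank, add_zero]) le_rfl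
  have hmod := (hu.mod hD.size).of_eq_of_le
    (y := D.rank l q) (by rw [Nat.mul_add_mod_self_right, Nat.mod_eq_of_lt hrank]) le_rfl
  refine .of_eq_of_le (hdiv.letE fun F₁ h₁ a ha => (hmod.mono h₁).letE fun F₂ h₂ b hb =>
    (hD.entry hl q (ha.mono h₂) hb).letE (T₂ := 78) fun F₃ h₃ e he => ?_) rfl (by norm_num)
  have ha₃ := (ha.mono h₂).mono h₃
  exact hD.mul_add (hD.levelScalar hl ha₃ 0 rfl) hD.size (hD.target hl q ha₃ (hb.mono h₃) he)
    (D.levelScalar_le (k := 0) hl rfl) hr ((D.rank (D.next l) q).2.le.trans hr)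

theorem position {a b : Code} {l T : ℕ} (hl : l ≤ D.levels) (q : Fin r)
    (ha : Computes mem code F a l 2) (hb : Computes mem code F b (D.rank l q) T) (hT : T ≤ 14) :
    Computes mem code F (.position a b) (D.rank D.levels q) (200 * D.depth) := by
  have hr : r ≤ 2 ^ (4 * D.bits) := D.scalar_le (k := 0) rfl
  have hrank (l : ℕ) : (D.rank l q : ℕ) < r := (D.rank l q).2
  have hinit := hD.mul_add ha hD.size hb (hl.trans (D.scalar_le (k := 1) rfl)) hr
    ((hrank l).le.trans hr)
  have hloop := Computes.forLoop (x := fun k => D.next^[k] l * r + D.rank (D.next^[k] l) q)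
    hinit (hD.scalar 3 rfl) (body := fun u _ => .jump u) (T₃ := 158) fun k _ F' _ u _ hu _ => by
      rw [Function.iterate_succ_apply']
      exact hD.jump (D.iterate_next_le hl k) q hu
  refine (hloop.mod hD.size).of_eq_of_le ?_ (by have := D.depth_pos; omega)
  rw [D.iterate_next_depth hl, Nat.mul_add_mod_self_right, Nat.mod_eq_of_lt (hrank _)]

theorem key {a b c : Code} {l x y T₁ T₂ : ℕ} (hl : l ≤ D.levels) (ha : Computes mem code F a l 2)
    (hb : Computes mem code F b x T₁) (hc : Computes mem code F c y T₂)
    (hy : y ≤ 2 ^ (4 * D.bits)) :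
    Computes mem code F (.key a b c) (x % D.base ^ l * (r * r) + y) (T₁ + T₂ + 24) := by
  have hmod : x % D.base ^ l ≤ 2 ^ (4 * D.bits) :=
    (Nat.mod_lt _ (Nat.pow_pos D.base_pos)).le.trans (D.levelScalar_le (k := 6) hl rfl)
  have hr : r ≤ 2 ^ (4 * D.bits) := D.scalar_le (k := 0) rfl
  have hsq := hD.size.mul (F := F) hD.size (hD.mul_add_lt (z := 0) hr hr (Nat.zero_le _))
  exact (hD.mul_add (hb.mod (hD.levelScalar hl ha 6 rfl)) hsq hc hmod D.mul_self_le
    hy).of_eq_of_le rfl (by omega)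

theorem digit {a b : Code} {l x T : ℕ} (hl : l ≤ D.levels) (ha : Computes mem code F a l 2)
    (hb : Computes mem code F b x T) : Computes mem code F (.digit a b) (D.digit l x) (T + 17) :=
  ((hb.div (hD.levelScalar hl ha 6 rfl)).mod (hD.scalar 2 rfl)).of_eq_of_le rfl (by omega)

theorem pointKey {a z : Code} {l : ℕ} (hl : l ≤ D.levels) (q : Fin r)
    (ha : Computes mem code F a l 2) (hz : Computes mem code F z (D.rank D.levels q) 2) :
    Computes mem code F (.key a (.segment 1 z) (.segment 2 z)) (D.levelKey l q) 36 :=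
  hD.key hl ha (hD.segment 1 (by omega) hz (D.getElem?_byRank _ _ q))
    (hD.segment 2 (by omega) hz (D.getElem?_byRank _ _ q))
    ((D.rowKey_lt q).le.trans D.mul_self_le)

theorem probe {a b c d : Code} {l t x m : ℕ} (hl : l ≤ D.levels) (hm : 0 < m)
    (ha : Computes mem code F a l 2) (hb : Computes mem code F b t 2)
    (hc : Computes mem code F c x 2) (hd : Computes mem code F d m 2) :
    Computes mem code F (.probe a b c d) (if m ≤ #{q | D.levelKey l q < t} then m else x)
      (200 * D.depth + 51) := by
  refine .of_eq_of_le (hD.size.iteLt (T₃ := 200 * D.depth + 43) hd (fun hlt => ?_) fun hle => ?_)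
    rfl (by omega)
  · have hcard : #{q | D.levelKey l q < t} ≤ r := (card_le_univ _).trans_eq (Fintype.card_fin r)
    rw [if_neg (by omega)]
    exact hc.of_eq_of_le rfl (by omega)
  · obtain ⟨q, hq⟩ := (D.rank l).surjective ⟨m - 1, by omega⟩
    have hrank : (D.rank l q : ℕ) = m - 1 := congrArg Fin.val hq
    have hiff : D.levelKey l q < t ↔ m ≤ #{q | D.levelKey l q < t} := by
      rw [← keyRank_lt_card_iff (D.levelKey_injective l), ← rank, hrank]
      omega
    have hpos := (hd.sub (hD.lit (k := 1) (by omega)) hm).of_eq_of_le hrank.symm le_rfl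
    refine (hD.position hl q ha hpos (by omega)).letE fun F' hF z hz => ?_
    refine (hD.pointKey hl q (ha.mono hF) hz).iteLt (T₃ := 2) (hb.mono hF) (fun hlt => ?_)
      fun hle => ?_
    · rw [if_pos (hiff.1 hlt)]
      exact hd.mono hF
    · rw [if_neg (mt hiff.2 hle.not_gt)]
      exact hc.mono hF

theorem search {a b : Code} {l t : ℕ} (hl : l ≤ D.levels)
    (ha : Computes mem code F a l 2) (hb : Computes mem code F b t 2) :
    Computes mem code F (.search a b) #{q | D.levelKey l q < t} (275 * D.bits * D.depth) := by
  set m : ℕ := #{q | D.levelKey l q < t}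
  have hmr : m ≤ r := (card_le_univ _).trans_eq (Fintype.card_fin r)
  have hinit : m / 2 ^ (D.bits - 0) * 2 ^ (D.bits - 0) = 0 := by
    rw [Nat.sub_zero, Nat.div_eq_of_lt (hmr.trans_lt D.lt_two_pow_bits), zero_mul]
  have hloop := Computes.forLoop (x := fun k => m / 2 ^ (D.bits - k) * 2 ^ (D.bits - k))
    ((hD.lit (F := F) (Nat.zero_le _)).of_eq_of_le hinit.symm le_rfl) (hD.scalar 6 rfl)
    (body := fun c i => .letE (c + Code.scalar 5 >>> i) fun m => .probe a b c m)
    (T₃ := 200 * D.depth + 64) fun k hk F₁ h₁ u i hu hi => ?_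
  · refine hloop.of_eq_of_le (by simp) ?_
    have := D.depth_pos
    nlinarith [D.two_le_bits, Nat.mul_le_mul D.two_le_bits D.depth_pos]
  · have hstep : 2 ^ (D.bits - 1) / 2 ^ k = 2 ^ (D.bits - (k + 1)) := by
      rw [Nat.pow_div (by omega) two_pos, Nat.sub_sub, add_comm]
    have hbits : D.bits - (k + 1) + 1 = D.bits - k := by omega
    have hhalf : 2 ^ (D.bits - (k + 1)) ≤ 2 ^ (4 * D.bits) :=
      Nat.pow_le_pow_right two_pos (by omega)
    have hlow : m / 2 ^ (D.bits - k) * 2 ^ (D.bits - k) ≤ 2 ^ (4 * D.bits) :=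
      (Nat.div_mul_le_self _ _).trans (hmr.trans (D.scalar_le (k := 0) rfl))
    have hlt : m / 2 ^ (D.bits - k) * 2 ^ (D.bits - k) + 2 ^ (D.bits - (k + 1)) < 2 ^ w := by
      simpa using hD.mul_add_lt hlow Nat.one_le_two_pow hhalf
    have hmid := hu.add (((hD.scalar 5 rfl).shiftRight hi).of_eq_of_le hstep le_rfl) hlt
    refine .of_eq_of_le (hmid.letE fun F₂ h₂ v hv => hD.probe hl ?_ ((ha.mono h₁).mono h₂)
      ((hb.mono h₁).mono h₂) (hu.mono h₂) hv) ?_ (by omega)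
    · exact Nat.add_pos_right _ (Nat.two_pow_pos _)
    · rw [div_two_pow_mul_two_pow m (D.bits - (k + 1)), hbits]

theorem scanStep {a b c d : Code} {l g T : ℕ} (hl : l ≤ D.levels) (q : Fin r)
    (ha : Computes mem code F a l 2) (hb : Computes mem code F b g 2)
    (hc : Computes mem code F c (D.rank l q) T) (hT : T ≤ 14)
    (hd : Computes mem code F d (code (D.prefixSum l g (D.rank l q))) 2) :
    Computes mem code F (.scanStep a b c d) (code (D.prefixSum l g (D.rank l q + 1)))
      (200 * D.depth + 37) := by
  refine (hD.position hl q ha hc hT).letE fun F' hF z hz => ?_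
  rw [D.prefixSum_rank_succ]
  have hdigit := hD.digit hl (ha.mono hF) (hD.segment 1 (by omega) hz (D.getElem?_byRank _ _ q))
  refine hdigit.iteLt (T₃ := 9) (hb.mono hF) (fun hlt => ?_) fun hle => ?_
  · rw [if_pos hlt]
    have hvalue := hD.segment 3 (by omega) hz (D.getElem?_byRank _ (fun q => code (D.value q)) q)
    exact (hd.mono hF).gadd hD.card_le hvalue
  · rw [if_neg hle.not_gt, add_zero]
    exact (hd.mono hF).of_eq_of_le rfl (by omega)

theorem scan {a b c : Code} {l g m : ℕ} (hl : l ≤ D.levels) (hg : g < D.base) (hm : m ≤ r)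
    (ha : Computes mem code F a l 2) (hb : Computes mem code F b g 2)
    (hc : Computes mem code F c m 2) :
    Computes mem code F (.scan a b c) (code (D.prefixSum l g m)) (242 * D.depth * D.block) := by
  have hr : r ≤ 2 ^ (4 * D.bits) := D.scalar_le (k := 0) rfl
  have hbase := D.scalar_le (k := 2) rfl
  have hmod (F : Frame w) (h : Computes mem code F c m 2) := h.mod (hD.scalar (F := F) 4 rfl)
  have hstart : m - m % D.block = m / D.block * D.block :=
    Nat.sub_eq_of_eq_add (Nat.div_add_mod' m D.block).symm
  have hsample := hD.levelSegment hl 3 (by omega) ha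
    (hD.mul_add (hc.div (hD.scalar 4 rfl)) (hD.scalar 2 rfl) hb
      ((Nat.div_le_self _ _).trans (hm.trans hr)) hbase (hg.le.trans hbase))
    (D.getElem?_samples code hg hm)
  have hloop := Computes.forLoop (x := fun j => code (D.prefixSum l g (m - m % D.block + j)))
    (by rwa [← hstart] at hsample) (hmod F hc)
    (body := fun s j => .scanStep a b (c - c % Code.scalar 4 + j) s)
    (T₃ := 200 * D.depth + 37) fun j hj F₁ h₁ s i hs hi => ?_
  · refine hloop.of_eq_of_le (by rw [Nat.sub_add_cancel (Nat.mod_le _ _)]) ?_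
    have hlt : m % D.block + 1 ≤ D.block := Nat.mod_lt _ (by have := D.four_le_block; omega)
    nlinarith [D.four_le_block, D.depth_pos, Nat.mul_le_mul_right (242 * D.depth) hlt]
  · have hmr : m - m % D.block + j < r := by have := Nat.mod_le m D.block; omega
    obtain ⟨q, hq⟩ := (D.rank l).surjective ⟨_, hmr⟩
    have hrank : (D.rank l q : ℕ) = m - m % D.block + j := congrArg Fin.val hq
    have hlt := hD.lt_two_pow (hmr.le.trans hr)
    have hpos := ((hc.mono h₁).sub (hmod F₁ (hc.mono h₁)) (Nat.mod_le _ _)).add hi hlt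
    rw [← add_assoc, ← hrank]
    exact hD.scanStep hl q (ha.mono h₁) (hb.mono h₁) (hpos.of_eq_of_le hrank.symm le_rfl)
      (by omega) (hs.of_eq_of_le (by rw [hrank]) le_rfl)

theorem levelSum {a b c : Code} {l x y : ℕ} (hl : l ≤ D.levels) (hy : y ≤ 2 ^ (4 * D.bits))
    (ha : Computes mem code F a x 2) (hb : Computes mem code F b y 2)
    (hc : Computes mem code F c l 2) :
    Computes mem code F (.levelSum a b c) (code (D.levelSum x y l))
      (531 * (D.depth * D.block)) := by
  set m : ℕ := #{q | D.levelKey l q < x % D.base ^ l * (r * r) + y} with hm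
  have hmr : m ≤ r := (card_le_univ _).trans_eq (Fintype.card_fin r)
  have hcost : D.bits * D.depth ≤ D.depth * D.block := by
    rw [mul_comm]
    exact Nat.mul_le_mul_left _ D.bits_le_block
  have := Nat.mul_le_mul D.depth_pos D.four_le_block
  refine .of_eq_of_le ((hD.key hl hc ha hb hy).letE fun F₁ h₁ t ht =>
    (hD.search hl (hc.mono h₁) ht).letE fun F₂ h₂ u hu =>
    (hD.digit hl ((hc.mono h₁).mono h₂) ((ha.mono h₁).mono h₂)).letE
      (T₂ := 242 * D.depth * D.block) fun F₃ h₃ g hg => ?_) rfl ?_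
  · exact (hD.scan hl (D.digit_lt l x) hmr (((hc.mono h₁).mono h₂).mono h₃) hg
      (hu.mono h₃)).of_eq_of_le (by rw [D.levelSum_eq_prefixSum, hm]) le_rfl
  · linarith

theorem cornerSum {a b : Code} {x y T : ℕ} (hx : x ≤ r) (hy : y ≤ r)
    (ha : Computes mem code F a x T) (hb : Computes mem code F b y T) (hT : T ≤ 4) :
    Computes mem code F (.cornerSum a b) (code (D.cornerSum x y))
      (550 * (D.levels * (D.depth * D.block))) := by
  have hmul : y * r ≤ 2 ^ (4 * D.bits) := (Nat.mul_le_mul_right r hy).trans D.mul_self_le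
  have hreversed : (D.directory code 4)[x]? = some (digitRev D.base D.levels x) := by
    simp [directory, Nat.lt_succ_of_le hx]
  have hblock := Nat.mul_le_mul_left D.levels (Nat.mul_le_mul D.depth_pos D.four_le_block)
  have hlevels := D.two_le_levels
  refine .of_eq_of_le ((hD.segment 4 (by omega) ha hreversed).letE fun F₁ h₁ x' hx' =>
    ((hb.mono h₁).mul hD.size (hD.lt_two_pow hmul)).letE
      (T₂ := 1 + 5 + D.levels * (531 * (D.depth * D.block) + 3 + 5) + 2)
      fun F₂ h₂ y' hy' => ?_) rfl ?_
  · refine Computes.forLoop (x := fun m => code (∑ l ∈ range m, D.levelSum _ (y * r) l))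
      (T₃ := 531 * (D.depth * D.block) + 3) (.gzero hD.card_le) (hD.scalar 1 rfl)
      fun l hl F₃ h₃ s i hs hi => ?_
    rw [sum_range_succ]
    exact (hs.gadd hD.card_le (hD.levelSum hl.le hmul ((hx'.mono h₂).mono h₃) (hy'.mono h₃)
      hi)).of_eq_of_le rfl (by omega)
  · linarith

theorem rectangle {a₁ a₂ b₁ b₂ : Code} {x₁ x₂ y₁ y₂ : Fin r}
    (ha₁ : Computes mem code F a₁ x₁ 2) (ha₂ : Computes mem code F a₂ x₂ 2)
    (hb₁ : Computes mem code F b₁ y₁ 2) (hb₂ : Computes mem code F b₂ y₂ 2) :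
    Computes mem code F (.rectangle a₁ a₂ b₁ b₂) (code (rectSum D.point D.value x₁ x₂ y₁ y₂))
      (2200 * (D.levels * (D.depth * D.block)) + 16) := by
  have hN := hD.card_le
  have hr : r < 2 ^ w := hD.lt_two_pow (D.scalar_le (k := 0) rfl)
  have hsucc {a : Code} {x : Fin r} (ha : Computes mem code F a x 2) :
      Computes mem code F (a + 1) (x + 1) 4 := ha.add (hD.lit (k := 1) (by omega)) (by omega)
  have hzero : Computes mem code F .gzero (code 0) 1 := .gzero hN
  refine .of_eq_of_le (ha₂.iteLt ha₁ (T₃ := 2200 * (D.levels * (D.depth * D.block)) + 11)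
    (fun hx => ?_) fun hx => .of_eq_of_le (hb₂.iteLt hb₁
    (T₃ := 2200 * (D.levels * (D.depth * D.block)) + 6) (fun hy => ?_) fun hy => ?_)
    rfl (by omega)) rfl (by omega)
  · exact hzero.of_eq_of_le (by rw [rectSum_eq_zero_of_lt _ _ (.inl hx)]) (by omega)
  · exact hzero.of_eq_of_le (by rw [rectSum_eq_zero_of_lt _ _ (.inr hy)]) (by omega)
  · have hright := (hD.cornerSum x₂.2 y₂.2 (hsucc ha₂) (hsucc hb₂) le_rfl).gadd hN
      ((hD.cornerSum x₂.2 y₁.2.le (hsucc ha₂) (hb₁.of_eq_of_le rfl (by omega)) le_rfl).gneg hN)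
    have hleft := (hD.cornerSum x₁.2.le y₂.2 (ha₁.of_eq_of_le rfl (by omega)) (hsucc hb₂)
      le_rfl).gadd hN ((hD.cornerSum x₁.2.le y₁.2.le ha₁ hb₁ (by omega)).gneg hN)
    refine (hright.gadd hN (hleft.gneg hN)).of_eq_of_le ?_ (by omega)
    rw [D.rectSum_eq_cornerSum hx hy]
    simp only [sub_eq_add_neg]

theorem exec_query (x₁ x₂ y₁ y₂ : Fin r) :
    ∃ s t, Exec mem code Code.query (initRegs w x₁ x₂ y₁ y₂) s t ∧
      (s 0).toNat = code (rectSum D.point D.value x₁ x₂ y₁ y₂) ∧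
      t ≤ 2210 * (D.levels * (D.depth * D.block)) := by
  have hr : r < 2 ^ w := hD.lt_two_pow (D.scalar_le (k := 0) rfl)
  have hreg {k : ℕ} (hk : k < 4) (x : Fin r)
      (hx : initRegs w x₁ x₂ y₁ y₂ k = BitVec.ofNat w x) :
      Computes mem code ⟨4, initRegs w x₁ x₂ y₁ y₂⟩ (.reg k) x 2 :=
    (Computes.reg hk).of_eq_of_le (by simp [hx, Nat.mod_eq_of_lt (x.2.trans hr)]) le_rfl
  have hcost := Nat.mul_le_mul D.two_le_levels (Nat.mul_le_mul D.depth_pos D.four_le_block)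
  obtain ⟨s, t, hs, _, hvalue, ht⟩ := hD.rectangle (hreg (k := 0) (by omega) x₁ rfl)
    (hreg (k := 1) (by omega) x₂ rfl) (hreg (k := 2) (by omega) y₁ rfl)
    (hreg (k := 3) (by omega) y₂ rfl) _ le_rfl
  exact ⟨_, _, .seq hs (Computes.exec_move s (by omega)), by rw [Function.update_self, hvalue],
    by omega⟩

end IsStored

end WaveletIndex

/-! ### Space and time bounds -/

theorem sum_range_mul_div_mod {M : Type*} [AddCommMonoid M] {n : ℕ} (f : ℕ → ℕ → M) (m : ℕ) :
    ∑ j ∈ range (n * m), f (j / n) (j % n) = ∑ l ∈ range m, ∑ k ∈ range n, f l k := by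
  induction m with
  | zero => simp
  | succ m ih =>
    rw [Nat.mul_succ, sum_range_add, ih, sum_range_succ]
    refine congrArg _ (sum_congr rfl fun k hk => ?_)
    have hlt := mem_range.1 hk
    rw [Nat.mul_add_div (by omega), Nat.div_eq_of_lt hlt, add_zero, Nat.mul_add_mod,
      Nat.mod_eq_of_lt hlt]

theorem pow_three_le_four_mul_two_pow (n : ℕ) : n ^ 3 ≤ 4 * 2 ^ n := by
  rcases lt_or_ge n 4 with hlt | hge
  · interval_cases n <;> norm_num
  · induction n, hge using Nat.le_induction with
    | base => norm_num
    | succ n hn ih =>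
      rw [pow_succ 2]
      nlinarith [mul_le_mul hn hn (by norm_num) n.zero_le]

namespace WaveletIndex

variable {r : ℕ} {G : Type*} (D : WaveletIndex r G)

section Space

theorem pow_three_bits_le : D.bits ^ 3 ≤ 8 * r := by
  have := pow_three_le_four_mul_two_pow D.bits
  have := D.two_pow_bits_le
  omega

theorem sq_bits_le : D.bits ^ 2 ≤ 4 * r := by
  have := D.pow_three_bits_le
  nlinarith [Nat.mul_le_mul_right (D.bits ^ 2) D.two_le_bits]

theorem levels_succ_le : D.levels + 1 ≤ 2 * r := by
  have := D.two_le_bits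
  have := D.levels_le
  have := D.two_le
  have := D.sq_bits_le
  nlinarith

theorem levels_succ_le_two_mul_bits : D.levels + 1 ≤ 2 * D.bits := by
  have := D.levels_le
  have := D.two_le_bits
  omega

theorem digitBits_mul_levels_le_two_mul_bits : D.digitBits * D.levels ≤ 2 * D.bits := by
  have := D.digitBits_mul_levels_le
  have := D.digitBits_le_bits
  omega

variable {D} {K : ℕ} (hK : D.bits + 1 ≤ D.base ^ K)
include hK

theorem height_lt_of_bits_lt : D.height < K := by
  refine (Nat.pow_lt_pow_iff_right D.two_le_base).1 ?_
  have := D.two_mul_base_pow_height_le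
  have := D.levels_le
  have := D.two_le_levels
  omega

theorem slack_le_of_bits_lt : D.slack ≤ 2 * (D.digitBits * K) := by
  have hclog : D.slack ≤ D.digitBits * K + 1 := Nat.clog_le_of_le_pow <| by
    rw [pow_succ', ← base_pow]
    have := D.levels_le
    omega
  have := Nat.mul_pos D.digitBits_pos (Nat.zero_lt_of_lt (height_lt_of_bits_lt hK))
  omega

theorem sum_symbolBits_le : ∑ l ∈ range (D.levels + 1), D.symbolBits l ≤ 2 * D.bits * K := by
  have hflip : ∑ l ∈ range (D.levels + 1), D.symbolBits l =
      D.digitBits * ∑ d ∈ Ioc 0 D.levels, (d - skip D.base D.height d) := by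
    rw [← sum_flip, mul_sum, Nat.range_succ_eq_Icc_zero, ← add_sum_Ioc_eq_sum_Icc D.levels.zero_le]
    refine (congrArg₂ _ ?_ (sum_congr rfl fun d hd => ?_)).trans (zero_add _)
    · simp [symbolBits, Nat.sub_eq_zero_of_le (D.next_le _)]
    · have hle := (mem_Ioc.1 hd).2
      rw [symbolBits, next, Nat.sub_sub_self hle]
      congr 1
      omega
  calc _ ≤ D.digitBits * ((D.height + 1) * D.levels) :=
        hflip.trans_le (Nat.mul_le_mul_left _ (sum_sub_skip_le D.base_pos _ _))
    _ = D.digitBits * D.levels * (D.height + 1) := by ring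
    _ ≤ 2 * D.bits * K :=
        Nat.mul_le_mul D.digitBits_mul_levels_le_two_mul_bits (height_lt_of_bits_lt hK)

theorem sum_entryBits_le : ∑ l ∈ range (D.levels + 1), D.entryBits l ≤ 12 * D.bits * K := by
  have hlevels : D.levels + 1 ≤ 2 * D.levels := by
    have := D.two_le_levels
    omega
  calc ∑ l ∈ range (D.levels + 1), D.entryBits l
    _ = 2 * ∑ l ∈ range (D.levels + 1), D.symbolBits l + (D.levels + 1) * D.slack := by
      simp [entryBits, sum_add_distrib, mul_sum]
    _ ≤ 2 * (2 * D.bits * K) + 2 * D.levels * (2 * (D.digitBits * K)) := by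
      gcongr
      · exact sum_symbolBits_le hK
      · exact slack_le_of_bits_lt hK
    _ = 4 * D.bits * K + 4 * K * (D.digitBits * D.levels) := by ring
    _ ≤ 4 * D.bits * K + 4 * K * (2 * D.bits) :=
      Nat.add_le_add_left (Nat.mul_le_mul_left _ D.digitBits_mul_levels_le_two_mul_bits) _
    _ = 12 * D.bits * K := by ring

omit hK in
theorem bits_mul_div_perWord_le (l : ℕ) : D.bits * (r / D.perWord l) ≤ r * D.entryBits l := by
  have hperWord : D.bits ≤ D.perWord l * D.entryBits l := by
    have hdecomp := Nat.div_add_mod' (4 * D.bits) (D.entryBits l)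
    have := Nat.mod_lt (4 * D.bits) (D.entryBits_pos l)
    have := D.entryBits_le l
    rw [perWord]
    omega
  calc D.bits * (r / D.perWord l)
    _ ≤ D.perWord l * D.entryBits l * (r / D.perWord l) := Nat.mul_le_mul_right _ hperWord
    _ = r / D.perWord l * D.perWord l * D.entryBits l := by ring
    _ ≤ r * D.entryBits l := Nat.mul_le_mul_right _ (Nat.div_mul_le_self _ _)

theorem sum_length_items_le :
    ∑ l ∈ range (D.levels + 1), (D.items l).length ≤ 12 * K * r + 2 * r := by
  have hbits : 0 < D.bits := two_pos.trans_le D.two_le_bits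
  have hwords : ∑ l ∈ range (D.levels + 1), r / D.perWord l ≤ 12 * K * r := by
    refine Nat.le_of_mul_le_mul_left ?_ hbits
    calc D.bits * ∑ l ∈ range (D.levels + 1), r / D.perWord l
      _ ≤ ∑ l ∈ range (D.levels + 1), r * D.entryBits l := by
        rw [mul_sum]
        exact sum_le_sum fun l _ => bits_mul_div_perWord_le l
      _ ≤ r * (12 * D.bits * K) := by
        rw [← mul_sum]
        exact Nat.mul_le_mul_left _ (sum_entryBits_le hK)
      _ = D.bits * (12 * K * r) := by ring
  simp only [items, List.length_map, List.length_range, sum_add_distrib, sum_const, card_range,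
    smul_eq_mul, mul_one]
  exact Nat.add_le_add hwords D.levels_succ_le

omit hK
variable (D)

theorem levels_succ_mul_two_pow_symbolBits_le (l : ℕ) :
    (D.levels + 1) * 2 ^ D.symbolBits l ≤ 12 * r := by
  have hsq : (2 ^ D.symbolBits l) ^ 2 ≤ 2 * r * (2 * D.bits) := by
    rw [← pow_mul, mul_comm _ 2]
    refine (Nat.pow_le_pow_right two_pos (D.two_mul_symbolBits_le l)).trans ?_
    rw [pow_add]
    exact Nat.mul_le_mul D.two_pow_bits_le D.base_le
  refine (Nat.pow_le_pow_iff_left two_ne_zero).1 ?_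
  calc ((D.levels + 1) * 2 ^ D.symbolBits l) ^ 2
    _ ≤ (2 * D.bits) ^ 2 * (2 * r * (2 * D.bits)) := by
      rw [mul_pow]
      exact Nat.mul_le_mul (Nat.pow_le_pow_left D.levels_succ_le_two_mul_bits 2) hsq
    _ = 16 * r * D.bits ^ 3 := by ring
    _ ≤ 16 * r * (8 * r) := Nat.mul_le_mul_left _ D.pow_three_bits_le
    _ ≤ (12 * r) ^ 2 := by nlinarith

theorem levels_succ_mul_length_bases_le (l : ℕ) :
    (D.levels + 1) * (D.bases l).length ≤ 13 * r := by
  have hslack : D.levels + 1 ≤ 2 ^ D.slack := Nat.le_pow_clog one_lt_two _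
  calc (D.levels + 1) * (D.bases l).length
    _ = (D.levels + 1) * (r / D.jumpBlock l * 2 ^ D.symbolBits l) +
        (D.levels + 1) * 2 ^ D.symbolBits l := by rw [bases, length_table]; ring
    _ ≤ 2 ^ D.slack * (r / D.jumpBlock l * 2 ^ D.symbolBits l) + 12 * r :=
      Nat.add_le_add (Nat.mul_le_mul_right _ hslack) (D.levels_succ_mul_two_pow_symbolBits_le l)
    _ = r / D.jumpBlock l * D.jumpBlock l + 12 * r := by rw [jumpBlock, pow_add]; ring
    _ ≤ r + 12 * r := Nat.add_le_add_right (Nat.div_mul_le_self _ _) _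
    _ = 13 * r := by ring

theorem levels_succ_mul_length_samples_le [AddCommGroup G] {N : ℕ} (code : G ≃ Fin N) (l : ℕ) :
    (D.levels + 1) * (D.samples code l).length ≤ 18 * r := by
  have hlevels : D.levels + 1 ≤ 2 * D.levels := by
    have := D.two_le_levels
    omega
  calc (D.levels + 1) * (D.samples code l).length
    _ = (D.levels + 1) * (r / D.block * D.base) + (D.levels + 1) * D.base := by
      rw [samples, length_table]
      ring
    _ ≤ 2 * D.levels * (r / D.block * D.base) + 2 * D.bits * (2 * D.bits) :=
      Nat.add_le_add (Nat.mul_le_mul_right _ hlevels)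
        (Nat.mul_le_mul D.levels_succ_le_two_mul_bits D.base_le)
    _ = 2 * (r / D.block * D.block) + 4 * D.bits ^ 2 := by rw [block]; ring
    _ ≤ 2 * r + 4 * (4 * r) := by
      gcongr
      · exact Nat.div_mul_le_self _ _
      · exact D.sq_bits_le
    _ = 18 * r := by ring

end Space

end WaveletIndex

theorem sum_range_le_of_mul_le {f : ℕ → ℕ} {m c : ℕ} (hf : ∀ l, m * f l ≤ c) :
    ∑ l ∈ range m, f l ≤ c := by
  rcases m.eq_zero_or_pos with rfl | hm
  · simp
  · calc ∑ l ∈ range m, f l ≤ #(range m) • (c / m) :=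
        sum_le_card_nsmul _ _ _ fun l _ =>
          (Nat.le_div_iff_mul_le hm).2 ((mul_comm _ _).trans_le (hf l))
      _ = m * (c / m) := by simp
      _ ≤ c := Nat.mul_div_le c m

namespace WaveletIndex

variable {r : ℕ} {G : Type*} [AddCommGroup G] (D : WaveletIndex r G) {N : ℕ} (code : G ≃ Fin N)

section Length

theorem sum_length_levelDirectory {K : ℕ} (hK : D.bits + 1 ≤ D.base ^ K) :
    ∑ l ∈ range (D.levels + 1), ∑ k ∈ range 4, (D.levelDirectory code l k).length ≤
      12 * K * r + 47 * r := by
  have hitems := sum_length_items_le hK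
  have hbases := sum_range_le_of_mul_le D.levels_succ_mul_length_bases_le
  have hsamples := sum_range_le_of_mul_le (D.levels_succ_mul_length_samples_le code)
  have hlevels := D.levels_succ_le
  simp only [sum_range_succ _ 3, sum_range_succ _ 2, sum_range_succ _ 1, sum_range_one,
    levelDirectory, sum_add_distrib]
  have hscalars : ∑ l ∈ range (D.levels + 1), (D.levelScalars l).length = 7 * (D.levels + 1) := by
    simp [levelScalars, mul_comm]
  omega

theorem length_pack_directory_le {K : ℕ} (hK : D.bits + 1 ≤ D.base ^ K) :
    (WordRAM.pack (D.directory code) D.segments).length ≤ 80 * K * r := by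
  have hsum : ∑ j ∈ range D.segments, (D.directory code j).length =
      (∑ l ∈ range (D.levels + 1), ∑ k ∈ range 4, (D.levelDirectory code l k).length) +
        (4 * r + 8) := by
    rw [← sum_range_mul_div_mod fun l k => (D.levelDirectory code l k).length, segments]
    simp only [sum_range_succ', directory, byRank, scalars, List.length_ofFn, List.length_map,
      List.length_range, List.length_cons, List.length_nil]
    ring
  have hlevels := D.sum_length_levelDirectory code hK
  have hK : 0 < K := Nat.zero_lt_of_lt (height_lt_of_bits_lt hK)
  have := D.levels_succ_le
  have := D.two_le
  rw [WordRAM.length_pack, hsum, segments]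
  nlinarith

theorem length_pack_directory_lt {w : ℕ} (hw : 16 * D.bits ≤ w) :
    (WordRAM.pack (D.directory code) D.segments).length < 2 ^ w := by
  have hlt : D.bits < 2 ^ D.bits := Nat.lt_two_pow_self
  have hK : D.bits + 1 ≤ D.base ^ D.bits :=
    (Nat.succ_le_of_lt hlt).trans (Nat.pow_le_pow_left D.two_le_base _)
  calc _ ≤ 80 * D.bits * r := D.length_pack_directory_le code hK
    _ ≤ 2 ^ 7 * 2 ^ D.bits * 2 ^ D.bits := by
      gcongr
      · norm_num
      · exact D.lt_two_pow_bits.le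
    _ = 2 ^ (7 + D.bits + D.bits) := by rw [← pow_add, ← pow_add]
    _ < 2 ^ w := Nat.pow_lt_pow_right one_lt_two (by have := D.two_le_bits; omega)

/-- The memory of the data structure. -/
def memory (w : ℕ) : List (BitVec w) :=
  (WordRAM.pack (D.directory code) D.segments).map (BitVec.ofNat w)

theorem isStored_memory {w : ℕ} (hw : 16 * D.bits ≤ w) (hN : N ≤ 2 ^ w) :
    D.IsStored (D.memory code w) code where
  storesSegments := ⟨rfl, D.length_pack_directory_lt code hw,
    D.directory_lt code (Nat.pow_le_pow_right two_pos (by omega)) hN⟩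
  card_le := hN
  bits_le := hw

theorem length_memory_le {K : ℕ} (hK : D.bits + 1 ≤ D.base ^ K) (w : ℕ) :
    (D.memory code w).length ≤ 80 * K * r :=
  (List.length_map _).trans_le (D.length_pack_directory_le code hK)

end Length

omit [AddCommGroup G] in
theorem levels_mul_depth_mul_block_le {K : ℕ} (hK : D.bits + 1 ≤ D.base ^ K) :
    D.levels * (D.depth * D.block) ≤ 12 * (K * (D.base ^ 2 * D.bits ^ 2)) := by
  have hheight := height_lt_of_bits_lt hK
  have hlevels : D.levels ≤ 2 * D.bits := (Nat.le_succ _).trans D.levels_succ_le_two_mul_bits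
  calc D.levels * (D.depth * D.block)
    _ ≤ D.levels * (D.base * (3 * K) * D.block) := by
      gcongr
      exact D.depth_le.trans (Nat.mul_le_mul_left _ (by omega))
    _ = 3 * K * D.base ^ 2 * D.levels ^ 2 := by rw [block]; ring
    _ ≤ 3 * K * D.base ^ 2 * (2 * D.bits) ^ 2 := by gcongr
    _ = 12 * (K * (D.base ^ 2 * D.bits ^ 2)) := by ring

end WaveletIndex

theorem logb_two_lt_size {r : ℕ} (hr : r ≠ 0) : Real.logb 2 r < Nat.size r := by
  rw [Real.logb_lt_iff_lt_rpow one_lt_two (by positivity), Real.rpow_natCast]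
  exact_mod_cast Nat.lt_size_self r

theorem size_le_logb_two_add_one (r : ℕ) : (Nat.size r : ℝ) ≤ Real.logb 2 r + 1 := by
  have hsize : Nat.size r ≤ Nat.log 2 r + 1 := Nat.size_le.2 (Nat.lt_pow_succ_log_self one_lt_two r)
  have hlog : (Nat.log 2 r : ℝ) ≤ Real.logb 2 r := Real.natLog_le_logb r 2
  have : (Nat.size r : ℝ) ≤ Nat.log 2 r + 1 := mod_cast hsize
  linarith

theorem one_le_logb_two {n : ℕ} (hn : 2 ≤ n) : 1 ≤ Real.logb 2 n := by
  rw [Real.le_logb_iff_rpow_le one_lt_two (by positivity), Real.rpow_one]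
  exact_mod_cast hn

theorem clog_two_le_two_mul_logb {n : ℕ} (hn : 2 ≤ n) :
    (Nat.clog 2 n : ℝ) ≤ 2 * Real.logb 2 n := by
  have hlogb := one_le_logb_two hn
  have hceil := Nat.ceil_lt_add_one (zero_le_one.trans hlogb)
  rw [show Real.logb 2 n = Real.logb (2 : ℕ) n by norm_num, Real.natCeil_logb_natCast] at hceil
  push_cast at hceil
  linarith

theorem exists_two_pow_near_rpow {L m : ℝ} (hL : 1 ≤ L) (hm : 1 ≤ m) :
    ∃ a K : ℕ, 0 < a ∧ (2 : ℝ) ^ a ≤ 2 * L ∧ ((2 : ℝ) ^ a) ^ 2 ≤ 4 * L ^ (1 / m) ∧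
      4 * L ≤ ((2 : ℝ) ^ a) ^ K ∧ (K : ℝ) ≤ 5 * m := by
  have hm0 : 0 < m := one_pos.trans_le hm
  have hL0 : 0 ≤ L := zero_le_one.trans hL
  have hx : 1 ≤ L ^ (1 / (2 * m)) := Real.one_le_rpow hL (by positivity)
  obtain ⟨n, hn, hn'⟩ := exists_nat_pow_near hx one_lt_two
  have hpow : (2 : ℝ) ^ (n + 1) ≤ 2 * L ^ (1 / (2 * m)) := by
    rw [pow_succ']
    linarith
  refine ⟨n + 1, ⌈2 * m⌉₊ + 2, n.succ_pos, hpow.trans ?_, ?_, ?_, ?_⟩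
  · have hexp : 1 / (2 * m) ≤ 1 := (div_le_one (by positivity)).2 (by linarith)
    simpa using Real.rpow_le_rpow_of_exponent_le hL hexp
  · calc ((2 : ℝ) ^ (n + 1)) ^ 2 ≤ (2 * L ^ (1 / (2 * m))) ^ 2 := by gcongr
      _ = 4 * L ^ (1 / m) := by
        rw [mul_pow, ← Real.rpow_mul_natCast hL0]
        norm_num
        field_simp
  · have hLpow : L ≤ ((2 : ℝ) ^ (n + 1)) ^ ⌈2 * m⌉₊ := by
      calc L = (L ^ (1 / (2 * m))) ^ (2 * m) := by
            rw [← Real.rpow_mul hL0, one_div_mul_cancel (by positivity), Real.rpow_one]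
        _ ≤ (L ^ (1 / (2 * m))) ^ (⌈2 * m⌉₊ : ℝ) :=
          Real.rpow_le_rpow_of_exponent_le hx (Nat.le_ceil _)
        _ ≤ ((2 : ℝ) ^ (n + 1)) ^ ⌈2 * m⌉₊ := by
          rw [Real.rpow_natCast]
          gcongr
    have htwo : (2 : ℝ) ≤ 2 ^ (n + 1) := le_self_pow₀ one_le_two n.succ_ne_zero
    calc 4 * L = L * 2 ^ 2 := by ring
      _ ≤ ((2 : ℝ) ^ (n + 1)) ^ ⌈2 * m⌉₊ * (2 ^ (n + 1)) ^ 2 := by gcongr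
      _ = _ := (pow_add _ _ _).symm
  · have hceil := Nat.ceil_lt_add_one (mul_nonneg zero_le_two hm0.le)
    push_cast
    linarith

namespace WaveletIndex

variable {r : ℕ} {G : Type*}

theorem exists_of_branching (hr : 2 ≤ r) (p : Fin r → Fin r × Fin r) (v : Fin r → G) {ε : ℝ}
    (hε : 0 < ε) : ∃ D : WaveletIndex r G, D.point = p ∧ D.value = v ∧
      (D.base : ℝ) ^ 2 ≤ 4 * Real.logb 2 r ^ ε ∧
      ∃ K : ℕ, D.bits + 1 ≤ D.base ^ K ∧ (K : ℝ) ≤ 5 * max 1 (1 / ε) := by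
  have hr0 : r ≠ 0 := by omega
  have hlogb := one_le_logb_two hr
  obtain ⟨a, K, ha, hle, hsq, hK, hKm⟩ := exists_two_pow_near_rpow hlogb (le_max_left 1 (1 / ε))
  have hexp : 1 / max 1 (1 / ε) ≤ ε := (one_div_le (by positivity) hε).2 (le_max_right _ _)
  have hsize : 2 ^ a ≤ 2 * Nat.size r := by
    exact_mod_cast hle.trans (mul_le_mul_of_nonneg_left (logb_two_lt_size hr0).le zero_le_two)
  refine ⟨⟨p, v, a, hr, ha, hsize⟩, rfl, rfl, ?_, K, ?_, hKm⟩
  · rw [base, Nat.cast_pow, Nat.cast_two]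
    exact hsq.trans (by gcongr)
  · have hbits : (Nat.size r + 1 : ℝ) ≤ (2 ^ a) ^ K := by
      linarith [size_le_logb_two_add_one r]
    exact_mod_cast hbits

theorem levels_mul_depth_mul_block_le_logb (D : WaveletIndex r G) {m ε : ℝ} {K : ℕ}
    (hbase : (D.base : ℝ) ^ 2 ≤ 4 * Real.logb 2 r ^ ε) (hK : D.bits + 1 ≤ D.base ^ K)
    (hKm : (K : ℝ) ≤ 5 * m) :
    ((D.levels * (D.depth * D.block) : ℕ) : ℝ) ≤ 960 * (m * Real.logb 2 r ^ (2 + ε)) := by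
  have hlogb := one_le_logb_two D.two_le
  have hbits : (D.bits : ℝ) ≤ 2 * Real.logb 2 r := by
    have := size_le_logb_two_add_one r
    rw [bits]
    linarith
  have hm : 0 ≤ 5 * m := K.cast_nonneg.trans hKm
  calc ((D.levels * (D.depth * D.block) : ℕ) : ℝ)
    _ ≤ 12 * (K * (D.base ^ 2 * D.bits ^ 2)) := mod_cast D.levels_mul_depth_mul_block_le hK
    _ ≤ 12 * (5 * m * (4 * Real.logb 2 r ^ ε * (2 * Real.logb 2 r) ^ 2)) := by gcongr
    _ = 960 * (m * Real.logb 2 r ^ (2 + ε)) := by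
      rw [Real.rpow_add (one_pos.trans_le hlogb), Real.rpow_two]
      ring

theorem length_memory_mul_le [AddCommGroup G] (D : WaveletIndex r G) {N : ℕ} (code : G ≃ Fin N)
    (hN : 2 ≤ N) (c : ℕ) {m : ℝ} {K : ℕ} (hK : D.bits + 1 ≤ D.base ^ K) (hKm : (K : ℝ) ≤ 5 * m) :
    (((D.memory code (c * Nat.clog 2 N)).length * (c * Nat.clog 2 N) : ℕ) : ℝ) ≤
      800 * c * (m * r * Real.logb 2 N) := by
  have hm : 0 ≤ 5 * m := K.cast_nonneg.trans hKm
  calc (((D.memory code (c * Nat.clog 2 N)).length * (c * Nat.clog 2 N) : ℕ) : ℝ)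
    _ ≤ 80 * K * r * (c * Nat.clog 2 N) :=
      mod_cast Nat.mul_le_mul_right _ (D.length_memory_le code hK _)
    _ ≤ 80 * (5 * m) * r * (c * (2 * Real.logb 2 N)) := by
      gcongr
      exact clog_two_le_two_mul_logb hN
    _ = 800 * c * (m * r * Real.logb 2 N) := by ring

theorem bits_le_mul_clog (D : WaveletIndex r G) {κ N : ℕ} (hN : 2 ≤ N) (hr : r ≤ N ^ κ) :
    D.bits ≤ (κ + 1) * Nat.clog 2 N := by
  have hclog : 0 < Nat.clog 2 N := Nat.clog_pos one_lt_two hN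
  refine Nat.size_le.2 ?_
  calc r ≤ (2 ^ Nat.clog 2 N) ^ κ :=
        hr.trans (Nat.pow_le_pow_left (Nat.le_pow_clog one_lt_two N) κ)
    _ < 2 ^ ((κ + 1) * Nat.clog 2 N) := by
      rw [← pow_mul]
      exact Nat.pow_lt_pow_right one_lt_two (by nlinarith)

end WaveletIndex

theorem mainTheorem4 (κ : ℕ) :
    ∃ (P : WordRAM.Prog) (c : ℕ) (C : ℝ),
      ∀ (ε : ℝ), 0 < ε →
      ∀ (r N : ℕ), 2 ≤ r → r ≤ N ^ κ →
      ∀ (G : Type*) [AddCommGroup G] (code : G ≃ Fin N)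
        (p : Fin r → Fin r × Fin r) (v : Fin r → G),
      ∃ mem : List (BitVec (c * Nat.clog 2 N)),
        ((mem.length * (c * Nat.clog 2 N) : ℕ) : ℝ)
            ≤ C * (max 1 (1 / ε) * r * Real.logb 2 N) ∧
        ∀ x₁ x₂ y₁ y₂ : Fin r,
          ∃ (s : WordRAM.Regs (c * Nat.clog 2 N)) (t : ℕ),
            WordRAM.Exec mem code P
              (WordRAM.initRegs (c * Nat.clog 2 N) x₁ x₂ y₁ y₂) s t ∧
            (s 0).toNat = (code (rectSum p v x₁ x₂ y₁ y₂) : ℕ) ∧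
            (t : ℝ) ≤ C * (max 1 (1 / ε) * Real.logb 2 r ^ (2 + ε)) := by
  refine ⟨WordRAM.Code.query, 16 * (κ + 1), 2210 * 960 * (κ + 1),
    fun ε hε r N hr hrN G _ code p v => ?_⟩
  have hN : 2 ≤ N := lt_of_pow_lt_pow_left₀ κ N.zero_le (by rw [one_pow]; exact hr.trans hrN)
  have hlogb := one_le_logb_two hr
  have hlogb_N := one_le_logb_two hN
  obtain ⟨D, rfl, rfl, hbase, K, hK, hKm⟩ := WaveletIndex.exists_of_branching hr p v hε
  have hD := D.isStored_memory (w := 16 * (κ + 1) * Nat.clog 2 N) code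
    (by rw [mul_assoc]; exact Nat.mul_le_mul_left _ (D.bits_le_mul_clog hN hrN))
    ((Nat.le_pow_clog one_lt_two N).trans (Nat.pow_le_pow_right two_pos (by nlinarith)))
  refine ⟨D.memory code _, (D.length_memory_mul_le code hN _ hK hKm).trans ?_,
    fun x₁ x₂ y₁ y₂ => ?_⟩
  · refine mul_le_mul_of_nonneg_right ?_ (by positivity)
    push_cast
    linarith
  · obtain ⟨s, t, hexec, hsum, ht⟩ := hD.exec_query x₁ x₂ y₁ y₂
    have hκX : 0 ≤ κ * (max 1 (1 / ε) * Real.logb 2 r ^ (2 + ε)) := by positivity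
    have htime := D.levels_mul_depth_mul_block_le_logb hbase hK hKm
    have ht' : (t : ℝ) ≤ 2210 * (D.levels * (D.depth * D.block) : ℕ) := mod_cast ht
    exact ⟨s, t, hexec, hsum, by linarith⟩
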